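/- Let $N\ge 1$, $\alpha\in(0,2)$ and $H=(H_1,\dots,H_N)\in(0,1)^N$. Write $\widehat g(\xi)=(2\pi)^{-1/2}\int_{\mathbb R}e^{-is\xi}g(s)\,ds$. Let $\psi$ be a Lemarié–Meyer mother wavelet: a real-valued Schwartz function on $\mathbb R$ with $\operatorname{supp}\widehat\psi\subseteq\{\xi:\ 2\pi/3\le|\xi|\le 8\pi/3\}$ such that the functions $\psi_{j,k}(x)=2^{j/2}\psi(2^jx-k)$, $(j,k)\in\mathbb Z^2$, form an orthonormal basis of $L^2(\mathbb R)$. For $v\in(0,1)$, $x,y,\xi\in\mathbb R$ and $(j,k)\in\mathbb Z^2$ put $$f_v(x,\xi)=\frac{e^{ix\xi}-1}{|\xi|^{v+1/\alpha}}\ (\xi\ne0),\quad f_v(x,0)=0,\qquad \psi^v(y)=\int_{\mathbb R}e^{iy\eta}\frac{\widehat\psi(\eta)}{|\eta|^{v+1/\alpha}}\,d\eta,$$ $$\widehat\psi_{\alpha,j,k}=2^{-j(1/\alpha-1/2)}\,\widehat{\psi_{j,k}},\qquad w^v_{\alpha,j,k}(x)=2^{j(1/\alpha-1/2)}\int_{\mathbb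 R}f_v(x,\xi)\,\widehat{\psi_{j,k}}(\xi)\,d\xi,$$ and for $J,K\in\mathbb Z^N$ and $\lambda\in\mathbb R^N$ put $\widehat\Psi_{\alpha,J,K}(\lambda)=\prod_{l=1}^N\widehat\psi_{\alpha,j_l,k_l}(\lambda_l)$. Let $\widetilde M_\alpha$ be a complex-valued rotationally invariant $\alpha$-stable random measure on $\mathbb R^N$ with Lebesgue control measure: for Borel sets $A$ of finite Lebesgue measure $|A|$, $\widetilde M_\alpha(A)$ is a complex random variable with $\mathbb E\exp\big(i\,\mathrm{Re}(\bar z\,\widetilde M_\alpha(A))\big)=\exp(-c|z|^\alpha|A|)$ for all $z\in\mathbb C$ (where $c>0$ is a fixed normalizing constant), its values on finitely many disjoint sets are independent, and for every sequence of disjoint Borel sets whose union has finite measure it is almost surely $\sigma$-additive along that sequence. For $f\in L^\alpha(\mathbb R^N)$, $\int f\,d\widetilde M_\alpha$ denotes the limit in probability of the integrals $\sum_i z_i\widetilde M_\alpha(A_i)$ of simple functions $\sum_i z_i\mathbf 1_{A_i}$ (with $A_i$ disjoint and of finite measure) that converge to $f$ in $L^\alpha(\mathbb R^N)$. Let $$Z^H(t)=\mathrm{Re}\int_{\mathbb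 R^N}\prod_{l=1}^N f_{H_l}(t_l,\lambda_l)\,\widetilde M_\alpha(d\lambda),\qquad \epsilon_{J,K}=\int_{\mathbb R^N}\overline{\widehat\Psi_{\alpha,J,K}(\lambda)}\,\widetilde M_\alpha(d\lambda).$$ Let $(\mathcal D_n)_{n\in\mathbb N}$ be finite subsets of $\mathbb Z^N\times\mathbb Z^N$ with $\mathcal D_n\subset\mathcal D_{n+1}$ for all $n$ and $\bigcup_n\mathcal D_n=\mathbb Z^N\times\mathbb Z^N$, and let $$U_n(t)=\mathrm{Re}\sum_{(J,K)\in\mathcal D_n}2^{-\langle J,H\rangle}\,\epsilon_{J,K}\prod_{l=1}^N\big\{\psi^{H_l}(2^{j_l}t_l-k_l)-\psi^{H_l}(-k_l)\big\}.$$ Then the stochastic integrals defining $\epsilon_{J,K}$ and $Z^H(t)$ exist (in particular their integrands belong to $L^\alpha(\mathbb R^N)$), and for every $t\in\mathbb R^N$: 1. the wavelet expansion of the kernel converges in $L^\alpha(\mathbb R^N)$: $$\sum_{(J,K)\in\mathcal D_n}\Big\{\prod_{l=1}^N w^{H_l}_{\alpha,j_l,k_l}(t_l)\Big\}\overline{\widehat\Psi_{\alpha,J,K}}\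 \longrightarrow\ \prod_{l=1}^N f_{H_l}(t_l,\cdot)\quad\text{as }n\to\infty,$$ that is, $\int_{\mathbb R^N}|\text{difference}|^\alpha\,d\lambda\to0$; 2. $U_n(t)$ converges in probability to $Z^H(t)$ as $n\to\infty$. -/

import Mathlib

open MeasureTheory ProbabilityTheory Filter Topology
open scoped ENNReal SchwartzMap ComplexConjugate

namespace HFSS

noncomputable section

/-! ### Fourier transform and Lemarié–Meyer wavelets on the line -/

/-- The unitary Fourier transform `ĝ(ξ) = (2π)^{-1/2} ∫ e^{-isξ} g(s) ds`. -/
def fourierHat (g : ℝ → ℂ) (ξ : ℝ) : ℂ :=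
  (((2 * Real.pi) ^ (-(1 / 2 : ℝ)) : ℝ) : ℂ) *
    ∫ s : ℝ, Complex.exp (-(Complex.I * (s : ℂ) * (ξ : ℂ))) * g s

/-- `ψ_{j,k}(x) = 2^{j/2} ψ(2^j x - k)`, regarded as a complex-valued function. -/
def psiJK (ψ : ℝ → ℝ) (j k : ℤ) (x : ℝ) : ℂ :=
  (((2 : ℝ) ^ ((j : ℝ) / 2) * ψ ((2 : ℝ) ^ j * x - (k : ℝ)) : ℝ) : ℂ)

/-- A Lemarié–Meyer mother wavelet: a real-valued Schwartz function whose Fourier transform is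
supported in the ring `2π/3 ≤ |ξ| ≤ 8π/3`, and whose dyadic dilations and integer translations
`ψ_{j,k}` form an orthonormal basis of `L²(ℝ)`. -/
structure IsLemarieMeyer (ψ : 𝓢(ℝ, ℝ)) : Prop where
  support_hat : tsupport (fourierHat fun x => (ψ x : ℂ)) ⊆
    {ξ : ℝ | 2 * Real.pi / 3 ≤ |ξ| ∧ |ξ| ≤ 8 * Real.pi / 3}
  orthonormal_basis : ∃ b : HilbertBasis (ℤ × ℤ) ℂ (Lp ℂ 2 (volume : Measure ℝ)),
    ∀ j k : ℤ, (b (j, k) : ℝ → ℂ) =ᵐ[volume] psiJK ψ j k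

/-- `ψ̂_{α,j,k} = 2^{-j(1/α - 1/2)} ψ̂_{j,k}`, where `ψ̂_{j,k}` is the Fourier transform of
`ψ_{j,k}`. -/
def psiHat (α : ℝ) (ψ : ℝ → ℝ) (j k : ℤ) (ξ : ℝ) : ℂ :=
  (((2 : ℝ) ^ (-((j : ℝ) * (1 / α - 1 / 2))) : ℝ) : ℂ) * fourierHat (psiJK ψ j k) ξ

/-- `f_v(x, ξ) = (e^{ixξ} - 1) / |ξ|^{v + 1/α}`; its value at `ξ = 0` is `0`. -/
def fKer (α v x ξ : ℝ) : ℂ :=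
  (Complex.exp (Complex.I * (x : ℂ) * (ξ : ℂ)) - 1) / ((|ξ| ^ (v + 1 / α) : ℝ) : ℂ)

/-- `w^v_{α,j,k}(x) = 2^{j(1/α - 1/2)} ∫ f_v(x, ξ) ψ̂_{j,k}(ξ) dξ`. -/
def wCoeff (α : ℝ) (ψ : ℝ → ℝ) (v : ℝ) (j k : ℤ) (x : ℝ) : ℂ :=
  (((2 : ℝ) ^ ((j : ℝ) * (1 / α - 1 / 2)) : ℝ) : ℂ) *
    ∫ ξ : ℝ, fKer α v x ξ * fourierHat (psiJK ψ j k) ξ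

/-- `ψ^v(y) = ∫ e^{iyη} ψ̂(η) / |η|^{v + 1/α} dη`. -/
def psiFrac (α : ℝ) (ψ : ℝ → ℝ) (v y : ℝ) : ℂ :=
  ∫ η : ℝ, Complex.exp (Complex.I * (y : ℂ) * (η : ℂ)) *
    (fourierHat (fun x => (ψ x : ℂ)) η / ((|η| ^ (v + 1 / α) : ℝ) : ℂ))

/-! ### Tensor products on `ℝ^N` -/

/-- `Ψ̂_{α,J,K}(λ) = ∏_l ψ̂_{α,j_l,k_l}(λ_l)`. -/
def bigPsiHat {N : ℕ} (α : ℝ) (ψ : ℝ → ℝ) (J K : Fin N → ℤ) (x : Fin N → ℝ) : ℂ :=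
  ∏ l, psiHat α ψ (J l) (K l) (x l)

/-- The harmonizable kernel `λ ↦ ∏_l (e^{i t_l λ_l} - 1) / |λ_l|^{H_l + 1/α}`. -/
def kernel {N : ℕ} (α : ℝ) (H t : Fin N → ℝ) (x : Fin N → ℝ) : ℂ :=
  ∏ l, fKer α (H l) (t l) (x l)

/-! ### Rotationally invariant stable random measures and their integrals -/

/-- `M` is a complex-valued rotationally invariant `α`-stable random measure on `ℝ^N` with Lebesgue
control measure: for each Borel set `A` of finite Lebesgue measure, `M A` is a complex random
variable with `E exp(i Re(conj z · M A)) = exp(-c |z|^α |A|)`; the values on disjoint sets are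
independent, and `M` is almost surely `σ`-additive along each sequence of disjoint sets. The
constant `c > 0` only fixes the normalization of the scale parameter. The values of `M` on sets
that are not Borel or have infinite measure are irrelevant. -/
structure IsStableRandomMeasure {N : ℕ} {Ω : Type*} [MeasurableSpace Ω] (α c : ℝ)
    (M : Set (Fin N → ℝ) → Ω → ℂ) (P : Measure Ω) : Prop where
  measurable : ∀ A, MeasurableSet A → volume A < ∞ → Measurable (M A)
  charFun_eq : ∀ A, MeasurableSet A → volume A < ∞ → ∀ z : ℂ,
    charFun (P.map (M A)) z = ((Real.exp (-(c * ‖z‖ ^ α * (volume A).toReal)) : ℝ) : ℂ)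
  independent : ∀ (n : ℕ) (A : Fin n → Set (Fin N → ℝ)), (∀ i, MeasurableSet (A i)) →
    (∀ i, volume (A i) < ∞) → Pairwise (fun i j => Disjoint (A i) (A j)) →
    iIndepFun (fun i => M (A i)) P
  sigma_additive : ∀ A : ℕ → Set (Fin N → ℝ), (∀ i, MeasurableSet (A i)) →
    volume (⋃ i, A i) < ∞ → Pairwise (fun i j => Disjoint (A i) (A j)) →
    ∀ᵐ ω ∂P, Tendsto (fun n => ∑ i ∈ Finset.range n, M (A i) ω) atTop (𝓝 (M (⋃ i, A i) ω))

/-- The integral `∑_z z · M(s = z)` of a simple function `s` with respect to `M`. -/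
def simpleIntegral {N : ℕ} {Ω : Type*} (M : Set (Fin N → ℝ) → Ω → ℂ)
    (s : SimpleFunc (Fin N → ℝ) ℂ) (ω : Ω) : ℂ :=
  ∑ z ∈ s.range, z * M (s ⁻¹' {z}) ω

/-- The random variable `X` is the stochastic integral of `f ∈ L^α(ℝ^N)` with respect to `M`:
it is the limit in probability of the integrals of simple functions, vanishing off a set of
finite measure, that converge to `f` in `L^α(ℝ^N)`. -/
def IsStableIntegral {N : ℕ} {Ω : Type*} [MeasurableSpace Ω] (α : ℝ)
    (M : Set (Fin N → ℝ) → Ω → ℂ) (P : Measure Ω) (f : (Fin N → ℝ) → ℂ) (X : Ω → ℂ) : Prop :=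
  MemLp f (ENNReal.ofReal α) volume ∧ Measurable X ∧
    ∃ s : ℕ → SimpleFunc (Fin N → ℝ) ℂ, (∀ n, (s n).FinMeasSupp volume) ∧
      Tendsto (fun n => eLpNorm (fun x => s n x - f x) (ENNReal.ofReal α) volume) atTop (𝓝 0) ∧
      TendstoInMeasure P (fun n => simpleIntegral M (s n)) atTop X

open Classical in
/-- The stochastic integral `∫ f dM` (a version of it; `0` if `f` has no integral). -/
def stableIntegral {N : ℕ} {Ω : Type*} [MeasurableSpace Ω] (α : ℝ)
    (M : Set (Fin N → ℝ) → Ω → ℂ) (P : Measure Ω) (f : (Fin N → ℝ) → ℂ) : Ω → ℂ :=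
  if h : ∃ X, IsStableIntegral α M P f X then h.choose else 0

/-! ### The harmonizable fractional stable sheet and its wavelet series -/

/-- `Z^H(t) = Re ∫ ∏_l (e^{i t_l λ_l} - 1) / |λ_l|^{H_l + 1/α} M(dλ)`. -/
def sheet {N : ℕ} {Ω : Type*} [MeasurableSpace Ω] (α : ℝ)
    (M : Set (Fin N → ℝ) → Ω → ℂ) (P : Measure Ω) (H t : Fin N → ℝ) (ω : Ω) : ℝ :=
  (stableIntegral α M P (kernel α H t) ω).re

/-- `ε_{J,K} = ∫ conj(Ψ̂_{α,J,K}) dM`. -/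
def epsJK {N : ℕ} {Ω : Type*} [MeasurableSpace Ω] (α : ℝ) (ψ : ℝ → ℝ)
    (M : Set (Fin N → ℝ) → Ω → ℂ) (P : Measure Ω) (J K : Fin N → ℤ) : Ω → ℂ :=
  stableIntegral α M P (fun x => conj (bigPsiHat α ψ J K x))

/-- The partial sum over `D` of the random wavelet series,
`Re ∑_{(J,K) ∈ D} 2^{-⟨J,H⟩} ε_{J,K} ∏_l (ψ^{H_l}(2^{j_l} t_l - k_l) - ψ^{H_l}(-k_l))`. -/
def partialSum {N : ℕ} {Ω : Type*} [MeasurableSpace Ω] (α : ℝ) (ψ : ℝ → ℝ)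
    (M : Set (Fin N → ℝ) → Ω → ℂ) (P : Measure Ω) (H : Fin N → ℝ)
    (D : Finset ((Fin N → ℤ) × (Fin N → ℤ))) (t : Fin N → ℝ) (ω : Ω) : ℝ :=
  (∑ p ∈ D, (((2 : ℝ) ^ (-(∑ l, (p.1 l : ℝ) * H l)) : ℝ) : ℂ) * epsJK α ψ M P p.1 p.2 ω *
    ∏ l, (psiFrac α ψ (H l) ((2 : ℝ) ^ (p.1 l) * t l - (p.2 l : ℝ)) -
      psiFrac α ψ (H l) (-(p.2 l : ℝ)))).re

end

end HFSS

/-! Both claims come down to convergence of the kernel expansion in `L^α`, because stochastic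
integration is continuous from `L^α` to convergence in probability. Indeed, independence on disjoint
sets gives the integral of a simple function `s` the characteristic function `exp(-c|w|^α ∫|s|^α)`,
and this bounds its tails by a multiple of `∫|s|^α` (`measure_simpleIntegral_gt_le`). The integral
thus extends to `L^α`, linearly and continuously (`tendstoInMeasure_of_isStableIntegral`). A change
of variables (`IsLemarieMeyer.wCoeff_eq`) shows that `U_n(t)` is the real part of the integral of
the partial kernel expansion.

The kernel expansion converges in `L^α` by dominated convergence. In dimension one, at most five
dyadic scales are active at a given frequency, and the coefficients are summable over translations
by Schwartz decay. The series is therefore absolutely convergent and dominated by a multiple of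
`|ξ|^{-(v+1/α)} min(1,|ξ|)`, whose `α`-th power is integrable since `0 < v < 1`
(`IsLemarieMeyer.exists_tsum_le`, `integrable_domFun_rpow`). Its sum is the kernel: away from
frequency zero the kernel is in `L²`, as `α < 2`, and the orthonormal expansion identifies the limit
almost everywhere (`IsLemarieMeyer.hasSum_series`). Multiplying absolutely convergent series passes
to `ℝ^N` (`hasSum_pi_prod`). -/

namespace HFSS

noncomputable section

/-! ### Stochastic integrals of simple functions -/

section StableMeasure

variable {N : ℕ} {Ω : Type*} [MeasurableSpace Ω] {P : Measure Ω} {α c : ℝ}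
  {M : Set (Fin N → ℝ) → Ω → ℂ}

/-- Additivity along the constant sequence `∅` makes `n · M ∅` convergent, so its increments `M ∅`
tend to zero. -/
lemma IsStableRandomMeasure.ae_empty (hM : IsStableRandomMeasure α c M P) :
    ∀ᵐ ω ∂P, M ∅ ω = 0 := by
  have h := hM.sigma_additive (fun _ => ∅) (by simp) (by simp) (by intro i j _; simp)
  filter_upwards [h] with ω hω
  simp only [Set.iUnion_empty, Finset.sum_const, Finset.card_range, nsmul_eq_mul] at hω
  have h2 := (hω.comp (tendsto_add_atTop_nat 1)).sub hω
  have h3 : (((fun n : ℕ => (n : ℂ) * M ∅ ω) ∘ fun a => a + 1) - fun n : ℕ => (n : ℂ) * M ∅ ω)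
      = fun _ => M ∅ ω := by
    funext n
    simp only [Pi.sub_apply, Function.comp]
    push_cast
    ring
  have h4 : Tendsto (fun _ : ℕ => M ∅ ω) atTop (𝓝 (M ∅ ω - M ∅ ω)) := h3 ▸ h2
  simpa using tendsto_nhds_unique tendsto_const_nhds h4

lemma IsStableRandomMeasure.ae_union (hM : IsStableRandomMeasure α c M P)
    {A B : Set (Fin N → ℝ)} (hA : MeasurableSet A) (hB : MeasurableSet B)
    (hA' : volume A < ∞) (hB' : volume B < ∞) (hAB : Disjoint A B) :
    ∀ᵐ ω ∂P, M (A ∪ B) ω = M A ω + M B ω := by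
  let S : ℕ → Set (Fin N → ℝ) := fun n => if n = 0 then A else if n = 1 then B else ∅
  have hU : ⋃ i, S i = A ∪ B := by
    ext x
    simp only [Set.mem_iUnion, S, Set.mem_union]
    constructor
    · rintro ⟨i, hi⟩
      split_ifs at hi
      · exact Or.inl hi
      · exact Or.inr hi
      · exact hi.elim
    · rintro (h | h)
      · exact ⟨0, by simpa using h⟩
      · exact ⟨1, by simpa using h⟩
  have h := hM.sigma_additive S (fun i => by simp only [S]; split_ifs <;> simp [hA, hB])
    (by rw [hU]; exact (measure_union_le A B).trans_lt (ENNReal.add_lt_top.2 ⟨hA', hB'⟩))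
    (by
      intro i j hij
      simp only [S]
      split_ifs <;> first | omega | simp | exact hAB | exact hAB.symm)
  filter_upwards [h, hM.ae_empty] with ω hω h0
  rw [hU] at hω
  refine tendsto_nhds_unique hω (tendsto_const_nhds.congr' ?_)
  filter_upwards [eventually_ge_atTop 2] with n hn
  obtain ⟨m, rfl⟩ := Nat.exists_eq_add_of_le hn
  rw [Finset.sum_range_add, Finset.sum_eq_zero (s := Finset.range m)]
  · simp [S, Finset.sum_range_succ]
  · intro i _
    simp [S, h0, show 2 + i ≠ 1 by omega]

lemma IsStableRandomMeasure.ae_biUnion (hM : IsStableRandomMeasure α c M P) {ι : Type*}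
    (s : Finset ι) {A : ι → Set (Fin N → ℝ)} (hA : ∀ i ∈ s, MeasurableSet (A i))
    (hA' : ∀ i ∈ s, volume (A i) < ∞) (hd : (s : Set ι).PairwiseDisjoint A) :
    ∀ᵐ ω ∂P, M (⋃ i ∈ s, A i) ω = ∑ i ∈ s, M (A i) ω := by
  classical
  induction s using Finset.induction_on with
  | empty => simpa using hM.ae_empty
  | insert a s ha ih =>
    have h1 := ih (fun i hi => hA i (by simp [hi])) (fun i hi => hA' i (by simp [hi]))
      (hd.subset (by simp))
    have h2 := hM.ae_union (A := A a) (B := ⋃ i ∈ s, A i) (hA a (by simp))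
      (Finset.measurableSet_biUnion _ fun i hi => hA i (by simp [hi])) (hA' a (by simp))
      ((measure_biUnion_finset_le s A).trans_lt
        (ENNReal.sum_lt_top.2 fun i hi => hA' i (by simp [hi])))
      (by
        simp only [Set.disjoint_iUnion_right]
        intro i hi
        exact hd (by simp) (by simp [hi]) (fun h => ha (h ▸ hi)))
    filter_upwards [h1, h2] with ω h1 h2
    rw [Finset.set_biUnion_insert, h2, h1, Finset.sum_insert ha]

/-- The integral of a simple function may be computed on any finer finite partition. -/
lemma simpleIntegral_map (hM : IsStableRandomMeasure α c M P) {β : Type*}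
    (r : SimpleFunc (Fin N → ℝ) β) (g : β → ℂ)
    (hr : ∀ y, g y ≠ 0 → volume (r ⁻¹' {y}) < ∞) :
    ∀ᵐ ω ∂P, simpleIntegral M (r.map g) ω = ∑ y ∈ r.range, g y * M (r ⁻¹' {y}) ω := by
  classical
  have key : ∀ z ∈ (r.map g).range, ∀ᵐ ω ∂P,
      z * M ((r.map g) ⁻¹' {z}) ω = ∑ y ∈ r.range with g y = z, g y * M (r ⁻¹' {y}) ω := by
    intro z _
    -- The fibre over `0` may have infinite measure, where `M` is uncontrolled; the coefficient `0`
    -- removes it.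
    by_cases hz : z = 0
    · refine Eventually.of_forall fun ω => ?_
      rw [hz, zero_mul, Finset.sum_eq_zero]
      intro y hy
      rw [(Finset.mem_filter.1 hy).2, zero_mul]
    · have h := hM.ae_biUnion (r.range.filter fun y => g y = z) (A := fun y => r ⁻¹' {y})
        (fun y _ => r.measurableSet_fiber y)
        (fun y hy => hr y (by rw [(Finset.mem_filter.1 hy).2]; exact hz))
        (fun i _ j _ hij => Disjoint.preimage _ (by simpa using hij))
      filter_upwards [h] with ω hω
      have hset : (r.map g) ⁻¹' {z} = ⋃ y ∈ r.range.filter (fun y => g y = z), r ⁻¹' {y} := by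
        ext x
        simp
      rw [hset, hω, Finset.mul_sum]
      refine Finset.sum_congr rfl fun y hy => ?_
      rw [(Finset.mem_filter.1 hy).2]
  have key' := (Finset.eventually_all (r.map g).range).2 key
  filter_upwards [key'] with ω hω
  rw [simpleIntegral, Finset.sum_congr rfl hω]
  refine Finset.sum_fiberwise_of_maps_to (fun y hy => ?_) _
  rw [SimpleFunc.range_map]
  exact Finset.mem_image_of_mem g hy

/-- All three simple functions are images of `s.pair t`, so their integrals are sums over one common
partition. -/
lemma simpleIntegral_linear (hM : IsStableRandomMeasure α c M P)
    (s t : SimpleFunc (Fin N → ℝ) ℂ) (hs : s.FinMeasSupp volume) (ht : t.FinMeasSupp volume)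
    (a b : ℂ) :
    ∀ᵐ ω ∂P, simpleIntegral M ((s.pair t).map fun p => a * p.1 + b * p.2) ω =
      a * simpleIntegral M s ω + b * simpleIntegral M t ω := by
  have hp : ∀ p : ℂ × ℂ, p ≠ 0 → volume ((s.pair t) ⁻¹' {p}) < ∞ :=
    fun p hp => (hs.pair ht).meas_preimage_singleton_ne_zero hp
  have h1 := simpleIntegral_map hM (s.pair t) (fun p => a * p.1 + b * p.2)
    (fun y hy => hp y (by rintro rfl; simp at hy))
  have h2 := simpleIntegral_map hM (s.pair t) Prod.fst
    (fun y hy => hp y (by rintro rfl; simp at hy))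
  have h3 := simpleIntegral_map hM (s.pair t) Prod.snd
    (fun y hy => hp y (by rintro rfl; simp at hy))
  filter_upwards [h1, h2, h3] with ω h1 h2 h3
  rw [SimpleFunc.map_fst_pair] at h2
  rw [SimpleFunc.map_snd_pair] at h3
  rw [h1, h2, h3, Finset.mul_sum, Finset.mul_sum, ← Finset.sum_add_distrib]
  exact Finset.sum_congr rfl fun y _ => by ring

lemma measurable_simpleIntegral (hM : IsStableRandomMeasure α c M P)
    {s : SimpleFunc (Fin N → ℝ) ℂ} (hs : s.FinMeasSupp volume) :
    Measurable (simpleIntegral M s) := by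
  refine Finset.measurable_fun_sum _ fun z _ => ?_
  by_cases hz : z = 0
  · simp [hz]
  · exact (hM.measurable _ (s.measurableSet_fiber z)
      (hs.meas_preimage_singleton_ne_zero hz)).const_mul z

lemma charFun_map_const_mul {X : Ω → ℂ} (hX : Measurable X) (z w : ℂ) :
    charFun (P.map fun ω => z * X ω) w = charFun (P.map X) (conj z * w) := by
  simp only [charFun_apply]
  rw [integral_map (by fun_prop) (by fun_prop), integral_map (by fun_prop) (by fun_prop)]
  congr 1
  funext ω
  congr 3
  simp only [Complex.inner, map_mul]
  congr 1
  ring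

/-- The values of `M` on the fibres are independent, so the characteristic function is a product and
the exponents `‖z‖^α |s⁻¹{z}|` add up to `∫ |s|^α`. -/
lemma charFun_simpleIntegral (hM : IsStableRandomMeasure α c M P) (hα : 0 < α)
    {s : SimpleFunc (Fin N → ℝ) ℂ} (hs : s.FinMeasSupp volume) (w : ℂ) :
    charFun (P.map (simpleIntegral M s)) w =
      ((Real.exp (-(c * ‖w‖ ^ α * (∫⁻ x, ‖s x‖ₑ ^ α).toReal)) : ℝ) : ℂ) := by
  classical
  let R : Finset ℂ := s.range.filter (· ≠ 0)
  have hfin : ∀ z ∈ R, volume (s ⁻¹' {z}) < ∞ :=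
    fun z hz => hs.meas_preimage_singleton_ne_zero (Finset.mem_filter.1 hz).2
  have hI : simpleIntegral M s = fun ω => ∑ z ∈ R, z * M (s ⁻¹' {z}) ω := by
    funext ω
    rw [simpleIntegral, Finset.sum_filter_of_ne]
    intro z _ hz h0
    exact hz (by rw [h0, zero_mul])
  have hmeas : ∀ z ∈ R, Measurable (M (s ⁻¹' {z})) :=
    fun z hz => hM.measurable _ (s.measurableSet_fiber z) (hfin z hz)
  have hind0 : iIndepFun (fun z : R => M (s ⁻¹' {(z : ℂ)})) P := by
    have h := hM.independent R.card (fun i => s ⁻¹' {((R.equivFin.symm i : R) : ℂ)})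
      (fun i => s.measurableSet_fiber _) (fun i => hfin _ (R.equivFin.symm i).2)
      (fun i j hij => Disjoint.preimage _ (by
        rw [Set.disjoint_singleton]
        exact fun h => hij (R.equivFin.symm.injective (Subtype.ext h))))
    have h2 := h.precomp (g := R.equivFin) R.equivFin.injective
    simpa using h2
  have hind : iIndepFun (R.restrict fun z ω => z * M (s ⁻¹' {z}) ω) P := by
    exact hind0.comp (fun z x => (z : ℂ) * x) (fun z => by fun_prop)
  rw [hI, hind.charFun_map_fun_finsetSum_eq_prod
    (fun z hz => ((hmeas z hz).const_mul z).aemeasurable), Finset.prod_apply]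
  have hterm : ∀ z ∈ R, charFun (P.map fun ω => z * M (s ⁻¹' {z}) ω) w =
      ((Real.exp (-(c * ‖w‖ ^ α * (‖z‖ ^ α * (volume (s ⁻¹' {z})).toReal))) : ℝ) : ℂ) := by
    intro z hz
    rw [charFun_map_const_mul (hmeas z hz), hM.charFun_eq _ (s.measurableSet_fiber z) (hfin z hz),
      norm_mul, Complex.norm_conj, Real.mul_rpow (norm_nonneg _) (norm_nonneg _)]
    congr 3
    ring
  rw [Finset.prod_congr rfl hterm, ← Complex.ofReal_prod, ← Real.exp_sum]
  congr 2
  rw [Finset.sum_neg_distrib, ← Finset.mul_sum]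
  congr 2
  have hl : ∫⁻ x, ‖s x‖ₑ ^ α = ∑ z ∈ R, ‖z‖ₑ ^ α * volume (s ⁻¹' {z}) := by
    have h1 : ∫⁻ x, ‖s x‖ₑ ^ α = ∫⁻ x, (s.map fun z => ‖z‖ₑ ^ α) x := rfl
    rw [h1, SimpleFunc.lintegral_eq_lintegral, SimpleFunc.map_lintegral, Finset.sum_filter_of_ne]
    rintro z _ hz rfl
    exact hz (by simp [hα])
  rw [hl, ENNReal.toReal_sum
    (fun z hz => ENNReal.mul_ne_top (by finiteness) (hfin z hz).ne)]
  refine Finset.sum_congr rfl fun z _ => ?_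
  rw [ENNReal.toReal_mul, ← ENNReal.toReal_rpow, toReal_enorm]

/-- The tail constant of a rotationally invariant stable variable. -/
def tailConst (α c r : ℝ) : ℝ := 4 * c * (4 / r) ^ α

/-- Tail estimate from a stable characteristic function. -/
lemma measureReal_inner_gt_le [IsProbabilityMeasure P] {X : Ω → ℂ} (hX : Measurable X)
    {σ : ℝ} (hσ : 0 ≤ σ) (hα : 0 < α) (hc : 0 < c)
    (hchar : ∀ w, charFun (P.map X) w = ((Real.exp (-(c * ‖w‖ ^ α * σ)) : ℝ) : ℂ))
    {a : ℂ} (ha : ‖a‖ = 1) {r : ℝ} (hr : 0 < r) :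
    P.real {ω | r < |inner ℝ a (X ω)|} ≤ 2 * c * (2 / r) ^ α * σ := by
  have : IsProbabilityMeasure (P.map X) := Measure.isProbabilityMeasure_map hX.aemeasurable
  -- The tail at `r` is at most `r/2` times the integral of `1 - charFun` over `[-2/r, 2/r]`, where
  -- `1 - e^{-x} ≤ x` applies.
  have h := measureReal_abs_inner_gt_le_integral_charFun (μ := P.map X) (a := a) hr
  rw [map_measureReal_apply hX (measurableSet_lt (by fun_prop) (by fun_prop))] at h
  refine h.trans ?_
  have hb : ‖∫ t in (-2 * r⁻¹)..(2 * r⁻¹), 1 - charFun (P.map X) (t • a)‖ ≤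
      c * (2 / r) ^ α * σ * |2 * r⁻¹ - -2 * r⁻¹| := by
    refine intervalIntegral.norm_integral_le_of_norm_le_const fun t ht => ?_
    have hr' : 0 < r⁻¹ := inv_pos.2 hr
    rw [Set.uIoc_of_le (by linarith)] at ht
    have ht' : |t| ≤ 2 / r := by
      rw [abs_le, div_eq_mul_inv]
      exact ⟨by linarith [ht.1], ht.2⟩
    rw [hchar, norm_smul, ha, mul_one, Real.norm_eq_abs, ← Complex.ofReal_one,
      ← Complex.ofReal_sub, Complex.norm_real, Real.norm_eq_abs]
    have hx : 0 ≤ c * |t| ^ α * σ := by positivity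
    rw [abs_of_nonneg (by linarith [Real.exp_le_one_iff.2 (neg_nonpos.2 hx)])]
    calc 1 - Real.exp (-(c * |t| ^ α * σ)) ≤ c * |t| ^ α * σ := by
          linarith [Real.add_one_le_exp (-(c * |t| ^ α * σ))]
      _ ≤ _ := by gcongr
  calc _ ≤ 2⁻¹ * r * (c * (2 / r) ^ α * σ * |2 * r⁻¹ - -2 * r⁻¹|) := by gcongr
    _ = 2 * c * (2 / r) ^ α * σ := by
      rw [show 2 * r⁻¹ - -2 * r⁻¹ = 4 * r⁻¹ by ring, abs_of_pos (by positivity)]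
      field_simp
      ring

lemma measure_simpleIntegral_gt_le [IsProbabilityMeasure P]
    (hM : IsStableRandomMeasure α c M P) (hα : 0 < α) (hc : 0 < c)
    {s : SimpleFunc (Fin N → ℝ) ℂ} (hs : s.FinMeasSupp volume) {r : ℝ} (hr : 0 < r) :
    P {ω | r < ‖simpleIntegral M s ω‖} ≤
      ENNReal.ofReal (tailConst α c r) * ∫⁻ x, ‖s x‖ₑ ^ α := by
  set X := simpleIntegral M s
  have hX : Measurable X := measurable_simpleIntegral hM hs
  have hfin : ∫⁻ x, ‖s x‖ₑ ^ α ≠ ∞ := by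
    have hm : MemLp s (ENNReal.ofReal α) volume :=
      (SimpleFunc.memLp_iff_finMeasSupp (by simp [hα]) (by simp)).2 hs
    have := lintegral_rpow_enorm_lt_top_of_eLpNorm_lt_top (by simp [hα]) (by simp) hm.2
    rw [ENNReal.toReal_ofReal hα.le] at this
    exact this.ne
  have hchar := charFun_simpleIntegral hM hα hs
  have h1 := measureReal_inner_gt_le hX ENNReal.toReal_nonneg hα hc hchar (a := 1)
    (by simp) (half_pos hr)
  have h2 := measureReal_inner_gt_le hX ENNReal.toReal_nonneg hα hc hchar (a := Complex.I)
    (by simp) (half_pos hr)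
  -- If the modulus exceeds `r`, the real or the imaginary part exceeds `r / 2`. Each of the two
  -- tails costs `2c(4/r)^α` times the integral, whence `tailConst`.
  have hsub : {ω | r < ‖X ω‖} ⊆ {ω | r / 2 < |inner ℝ (1 : ℂ) (X ω)|} ∪
      {ω | r / 2 < |inner ℝ Complex.I (X ω)|} := by
    intro ω hω
    simp only [Set.mem_ofPred_eq, Set.mem_union, Complex.inner] at hω ⊢
    by_contra! hcon
    have := Complex.norm_le_abs_re_add_abs_im (X ω)
    simp at hcon
    linarith
  have h3 : P.real {ω | r < ‖X ω‖} ≤ tailConst α c r * (∫⁻ x, ‖s x‖ₑ ^ α).toReal := by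
    refine (measureReal_mono hsub).trans ((measureReal_union_le _ _).trans ?_)
    rw [show 2 / (r / 2) = 4 / r by field_simp; norm_num] at h1 h2
    rw [tailConst]
    linarith
  rw [← ENNReal.ofReal_toReal hfin, ← ENNReal.ofReal_mul (by unfold tailConst; positivity)]
  exact (ENNReal.le_ofReal_iff_toReal_le (measure_ne_top _ _)
    (mul_nonneg (by unfold tailConst; positivity) ENNReal.toReal_nonneg)).2 h3

end StableMeasure

/-! ### Stochastic integrals of functions in `L^α` -/

lemma tendstoInMeasure_mul_add_mul {Ω : Type*} [MeasurableSpace Ω] {P : Measure Ω}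
    {f g : ℕ → Ω → ℂ} {X Y : Ω → ℂ} (hf : TendstoInMeasure P f atTop X)
    (hg : TendstoInMeasure P g atTop Y) (a b : ℂ) :
    TendstoInMeasure P (fun n ω => a * f n ω + b * g n ω) atTop fun ω => a * X ω + b * Y ω := by
  rw [tendstoInMeasure_iff_norm] at *
  intro ε hε
  -- The extra `1` covers `a = b = 0` and leaves the strict slack `δ` for the contradiction.
  have hd : 0 < ‖a‖ + ‖b‖ + 1 := by positivity
  set δ := ε / (‖a‖ + ‖b‖ + 1) with hδ
  have hδ0 : 0 < δ := by positivity
  have h := (hf δ hδ0).add (hg δ hδ0)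
  rw [add_zero] at h
  refine tendsto_of_tendsto_of_tendsto_of_le_of_le tendsto_const_nhds h (fun _ => zero_le)
    fun n => (measure_mono fun ω hω => ?_).trans (measure_union_le _ _)
  simp only [Set.mem_ofPred_eq, Set.mem_union] at hω ⊢
  by_contra! hcon
  have h1 : ‖a * f n ω + b * g n ω - (a * X ω + b * Y ω)‖ ≤
      ‖a‖ * ‖f n ω - X ω‖ + ‖b‖ * ‖g n ω - Y ω‖ := by
    rw [show a * f n ω + b * g n ω - (a * X ω + b * Y ω) =
      a * (f n ω - X ω) + b * (g n ω - Y ω) by ring, ← norm_mul, ← norm_mul]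
    exact norm_add_le _ _
  have h2 : ‖a‖ * ‖f n ω - X ω‖ ≤ ‖a‖ * δ := by gcongr; exact hcon.1.le
  have h3 : ‖b‖ * ‖g n ω - Y ω‖ ≤ ‖b‖ * δ := by gcongr; exact hcon.2.le
  have h4 : (‖a‖ + ‖b‖ + 1) * δ = ε := by rw [hδ]; field_simp
  nlinarith

section StableIntegral

variable {N : ℕ} {Ω : Type*} [MeasurableSpace Ω] {P : Measure Ω} {α c : ℝ}
  {M : Set (Fin N → ℝ) → Ω → ℂ}

lemma lintegral_enorm_rpow_eq {E : Type*} [MeasurableSpace E] {μ : Measure E} (hα : 0 < α)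
    (g : E → ℂ) : ∫⁻ x, ‖g x‖ₑ ^ α ∂μ = eLpNorm g (ENNReal.ofReal α) μ ^ α := by
  rw [eLpNorm_eq_lintegral_rpow_enorm_toReal (by simp [hα]) (by simp),
    ENNReal.toReal_ofReal hα.le, ← ENNReal.rpow_mul, one_div_mul_cancel hα.ne', ENNReal.rpow_one]

/-- For exponents below `1` the triangle inequality holds only up to the factor `LpAddConst`, which
is finite and so harmless in limits. -/
lemma eLpNorm_sub_le_mul {E : Type*} [MeasurableSpace E] {μ : Measure E} {f g h : E → ℂ}
    (hf : AEStronglyMeasurable f μ) (hg : AEStronglyMeasurable g μ) (hh : AEStronglyMeasurable h μ)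
    (p : ℝ≥0∞) : eLpNorm (fun x => f x - g x) p μ ≤
      ENNReal.LpAddConst p *
        (eLpNorm (fun x => f x - h x) p μ + eLpNorm (fun x => g x - h x) p μ) := by
  have h1 : (fun x => f x - g x) = (fun x => f x - h x) + -(fun x => g x - h x) := by
    funext x
    simp
  rw [h1]
  refine (eLpNorm_add_le' (hf.sub hh) (hg.sub hh).neg p).trans ?_
  rw [eLpNorm_neg]
  exact le_rfl

lemma tendsto_const_mul_rpow_zero {ι : Type*} {l : Filter ι} {u : ι → ℝ≥0∞}
    (hu : Tendsto u l (𝓝 0)) (hα : 0 < α) {C : ℝ≥0∞} (hC : C ≠ ∞) :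
    Tendsto (fun i => C * u i ^ α) l (𝓝 0) := by
  have h1 := (ENNReal.continuous_rpow_const (y := α)).tendsto 0 |>.comp hu
  rw [ENNReal.zero_rpow_of_pos hα] at h1
  simpa using ENNReal.Tendsto.const_mul h1 (Or.inr hC)

lemma measure_simpleIntegral_sub_gt_le [IsProbabilityMeasure P]
    (hM : IsStableRandomMeasure α c M P) (hα : 0 < α) (hc : 0 < c)
    {s t : SimpleFunc (Fin N → ℝ) ℂ} (hs : s.FinMeasSupp volume) (ht : t.FinMeasSupp volume)
    {r : ℝ} (hr : 0 < r) :
    P {ω | r < ‖simpleIntegral M s ω - simpleIntegral M t ω‖} ≤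
      ENNReal.ofReal (tailConst α c r) *
        eLpNorm (fun x => s x - t x) (ENNReal.ofReal α) volume ^ α := by
  set d : SimpleFunc (Fin N → ℝ) ℂ := (s.pair t).map fun p => 1 * p.1 + (-1) * p.2 with hd
  have hds : d.FinMeasSupp volume := (hs.pair ht).map (by simp)
  have h1 := measure_simpleIntegral_gt_le hM hα hc hds hr
  have h2 := simpleIntegral_linear hM s t hs ht 1 (-1)
  have h3 : (fun x => s x - t x) = d := by
    funext x
    simp [hd, sub_eq_add_neg]
  rw [h3, ← lintegral_enorm_rpow_eq hα]
  refine le_trans (measure_mono_ae ?_) h1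
  filter_upwards [h2] with ω hω hlt
  change r < ‖simpleIntegral M d ω‖
  rw [hω]
  have hlt' : r < ‖simpleIntegral M s ω - simpleIntegral M t ω‖ := hlt
  simpa [sub_eq_add_neg] using hlt'

/-- The tail estimate makes the integrals of approximating simple functions Cauchy in probability.
Borel–Cantelli gives an almost sure limit along a subsequence, and that subsequence already serves
as the approximating sequence in the definition. -/
lemma exists_isStableIntegral [IsProbabilityMeasure P]
    (hM : IsStableRandomMeasure α c M P) (hα : 0 < α) (hc : 0 < c)
    {f : (Fin N → ℝ) → ℂ} (hf : MemLp f (ENNReal.ofReal α) volume) :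
    ∃ X, IsStableIntegral α M P f X := by
  have hp0 : ENNReal.ofReal α ≠ 0 := by simp [hα]
  have hs : ∀ n : ℕ, ∃ s : SimpleFunc (Fin N → ℝ) ℂ, s.FinMeasSupp volume ∧
      eLpNorm (fun x => s x - f x) (ENNReal.ofReal α) volume ≤ ((n : ℝ≥0∞) + 1)⁻¹ := by
    intro n
    obtain ⟨g, hg, hg'⟩ := hf.exists_simpleFunc_eLpNorm_sub_lt (by simp)
      (ε := ((n : ℝ≥0∞) + 1)⁻¹) (by simp)
    refine ⟨g, (SimpleFunc.memLp_iff_finMeasSupp hp0 (by simp)).1 hg', ?_⟩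
    rw [eLpNorm_sub_comm] at hg
    exact hg.le
  choose s hsfin hsle using hs
  have hslim : Tendsto (fun n => eLpNorm (fun x => s n x - f x) (ENNReal.ofReal α) volume)
      atTop (𝓝 0) := by
    refine tendsto_of_tendsto_of_tendsto_of_le_of_le tendsto_const_nhds ?_
      (fun _ => zero_le) hsle
    have := ENNReal.tendsto_inv_nat_nhds_zero.comp (tendsto_add_atTop_nat 1)
    simpa [Function.comp_def] using this
  have hcauchy : ∀ r : ℝ, 0 < r → Tendsto (fun q : ℕ × ℕ =>
      P {ω | r < ‖simpleIntegral M (s q.1) ω - simpleIntegral M (s q.2) ω‖})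
      atTop (𝓝 0) := by
    intro r hr
    have hsum : Tendsto (fun q : ℕ × ℕ => ENNReal.LpAddConst (ENNReal.ofReal α) *
        (eLpNorm (fun x => s q.1 x - f x) (ENNReal.ofReal α) volume +
          eLpNorm (fun x => s q.2 x - f x) (ENNReal.ofReal α) volume)) atTop (𝓝 0) := by
      rw [← prod_atTop_atTop_eq]
      have h := (hslim.comp (tendsto_fst (g := atTop))).add
        (hslim.comp (tendsto_snd (f := atTop)))
      rw [add_zero] at h
      simpa using ENNReal.Tendsto.const_mul h (Or.inr (ENNReal.LpAddConst_lt_top _).ne)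
    refine tendsto_of_tendsto_of_tendsto_of_le_of_le tendsto_const_nhds
      (tendsto_const_mul_rpow_zero hsum hα (C := ENNReal.ofReal (tailConst α c r)) (by simp))
      (fun _ => zero_le) fun q => ?_
    refine (measure_simpleIntegral_sub_gt_le hM hα hc (hsfin q.1) (hsfin q.2) hr).trans ?_
    gcongr
    exact eLpNorm_sub_le_mul (s q.1).stronglyMeasurable.aestronglyMeasurable
      (s q.2).stronglyMeasurable.aestronglyMeasurable hf.1 _
  obtain ⟨φ, hφ, hφ'⟩ := extraction_forall_of_eventually'
    (P := fun k m => ∀ a b, m ≤ a → m ≤ b →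
      P {ω | (1 / 2 : ℝ) ^ k < ‖simpleIntegral M (s a) ω - simpleIntegral M (s b) ω‖} ≤
        ENNReal.ofReal ((1 / 2 : ℝ) ^ k)) (by
      intro k
      have h := (hcauchy ((1 / 2) ^ k) (by positivity)).eventually_le_const
        (u := ENNReal.ofReal ((1 / 2 : ℝ) ^ k)) (by simp)
      obtain ⟨⟨a₀, b₀⟩, hab⟩ := eventually_atTop.1 h
      refine ⟨max a₀ b₀, fun m hm a b ha hb => hab (a, b) ⟨?_, ?_⟩⟩
      · exact (le_max_left _ _).trans (hm.trans ha)
      · exact (le_max_right _ _).trans (hm.trans hb))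
  have hBC : ∀ᵐ ω ∂P, ∀ᶠ k in atTop, ¬ (1 / 2 : ℝ) ^ k <
      ‖simpleIntegral M (s (φ (k + 1))) ω - simpleIntegral M (s (φ k)) ω‖ := by
    refine ae_eventually_notMem (s := fun k => {ω | (1 / 2 : ℝ) ^ k <
      ‖simpleIntegral M (s (φ (k + 1))) ω - simpleIntegral M (s (φ k)) ω‖}) ?_
    refine ne_top_of_le_ne_top (b := ∑' k : ℕ, ENNReal.ofReal ((1 / 2 : ℝ) ^ k)) ?_
      (ENNReal.tsum_le_tsum fun k => hφ' k _ _ (hφ.monotone (Nat.le_succ k)) le_rfl)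
    rw [← ENNReal.ofReal_tsum_of_nonneg (fun _ => by positivity) summable_geometric_two]
    simp
  have hconv : ∀ᵐ ω ∂P, ∃ l : ℂ,
      Tendsto (fun k => simpleIntegral M (s (φ k)) ω) atTop (𝓝 l) := by
    filter_upwards [hBC] with ω hω
    refine cauchySeq_tendsto_of_complete (cauchySeq_of_summable_dist ?_)
    refine Summable.of_norm_bounded_eventually_nat summable_geometric_two ?_
    filter_upwards [hω] with k hk
    rw [Real.norm_of_nonneg dist_nonneg, dist_comm, dist_eq_norm]
    exact not_lt.1 hk
  obtain ⟨X, hX, hlim⟩ := measurable_limit_of_tendsto_metrizable_ae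
    (fun k => (measurable_simpleIntegral hM (hsfin (φ k))).aemeasurable) hconv
  refine ⟨X, hf, hX, fun k => s (φ k), fun k => hsfin _, hslim.comp hφ.tendsto_atTop,
    tendstoInMeasure_of_tendsto_ae
      (fun k => (measurable_simpleIntegral hM (hsfin (φ k))).aestronglyMeasurable) hlim⟩

lemma isStableIntegral_stableIntegral [IsProbabilityMeasure P]
    (hM : IsStableRandomMeasure α c M P) (hα : 0 < α) (hc : 0 < c)
    {f : (Fin N → ℝ) → ℂ} (hf : MemLp f (ENNReal.ofReal α) volume) :
    IsStableIntegral α M P f (stableIntegral α M P f) := by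
  have h := exists_isStableIntegral hM hα hc hf
  rw [stableIntegral, dif_pos h]
  exact h.choose_spec

/-- Linearity is stated for the relation, so it applies to any versions of the integrals and almost
sure uniqueness is not needed. -/
lemma IsStableIntegral.linear (hM : IsStableRandomMeasure α c M P)
    {f g : (Fin N → ℝ) → ℂ} {X Y : Ω → ℂ} (hX : IsStableIntegral α M P f X)
    (hY : IsStableIntegral α M P g Y) (a b : ℂ) :
    IsStableIntegral α M P (fun x => a * f x + b * g x) (fun ω => a * X ω + b * Y ω) := by
  obtain ⟨hf, hXm, s, hs, hsf, hsX⟩ := hX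
  obtain ⟨hg, hYm, t, ht, htg, htY⟩ := hY
  refine ⟨(hf.const_mul a).add (hg.const_mul b), (hXm.const_mul a).add (hYm.const_mul b),
    fun n => ((s n).pair (t n)).map fun p => a * p.1 + b * p.2,
    fun n => ((hs n).pair (ht n)).map (by simp), ?_, ?_⟩
  · have h := ((ENNReal.Tendsto.const_mul hsf (Or.inr (enorm_ne_top (x := a)))).add
      (ENNReal.Tendsto.const_mul htg (Or.inr (enorm_ne_top (x := b)))))
    rw [mul_zero, mul_zero, add_zero] at h
    have h' := ENNReal.Tendsto.const_mul h
      (Or.inr (ENNReal.LpAddConst_lt_top (ENNReal.ofReal α)).ne)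
    rw [mul_zero] at h'
    refine tendsto_of_tendsto_of_tendsto_of_le_of_le tendsto_const_nhds h'
      (fun _ => zero_le) fun n => ?_
    have h1 : (fun x => (((s n).pair (t n)).map fun p => a * p.1 + b * p.2) x -
        (a * f x + b * g x)) = a • (fun x => s n x - f x) + b • (fun x => t n x - g x) := by
      funext x
      simp
      ring
    simp only [h1]
    have hm1 : AEStronglyMeasurable (fun x => s n x - f x) volume :=
      (s n).stronglyMeasurable.aestronglyMeasurable.sub hf.1
    have hm2 : AEStronglyMeasurable (fun x => t n x - g x) volume :=
      (t n).stronglyMeasurable.aestronglyMeasurable.sub hg.1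
    refine (eLpNorm_add_le' (hm1.const_smul a) (hm2.const_smul b) _).trans ?_
    rw [eLpNorm_const_smul, eLpNorm_const_smul]
  · refine (tendstoInMeasure_mul_add_mul hsX htY a b).congr_left fun n => ?_
    filter_upwards [simpleIntegral_linear hM (s n) (t n) (hs n) (ht n) a b] with ω hω
    exact hω.symm

lemma isStableIntegral_zero :
    IsStableIntegral α M P (fun _ => 0) (fun _ => 0) := by
  refine ⟨MemLp.zero, measurable_const, fun _ => 0,
    fun _ => SimpleFunc.finMeasSupp_iff_support.2 (by simp), ?_, ?_⟩
  · simp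
  · have h : simpleIntegral M (0 : SimpleFunc (Fin N → ℝ) ℂ) = fun _ => 0 := by
      funext ω
      refine Finset.sum_eq_zero fun z hz => ?_
      obtain ⟨x, hx⟩ := SimpleFunc.mem_range.1 hz
      rw [← hx]
      simp
    simp only [h]
    intro ε hε
    simp [hε.ne']

lemma IsStableIntegral.sum (hM : IsStableRandomMeasure α c M P) {ι : Type*} (D : Finset ι)
    {f : ι → (Fin N → ℝ) → ℂ} {X : ι → Ω → ℂ} (hX : ∀ i, IsStableIntegral α M P (f i) (X i))
    (a : ι → ℂ) :
    IsStableIntegral α M P (fun x => ∑ i ∈ D, a i * f i x) (fun ω => ∑ i ∈ D, a i * X i ω) := by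
  classical
  induction D using Finset.induction_on with
  | empty => simpa using isStableIntegral_zero
  | insert i D hi ih =>
    simpa only [Finset.sum_insert hi, one_mul] using (hX i).linear hM ih (a i) 1

/-- The tail bound passes to the limit: if `‖X‖ ≥ r`, then either `X` is at distance at least `r /
3` from the simple integral, an event of vanishing probability, or that simple integral exceeds `r /
3`. -/
lemma IsStableIntegral.measure_ge_le [IsProbabilityMeasure P]
    (hM : IsStableRandomMeasure α c M P) (hα : 0 < α) (hc : 0 < c)
    {f : (Fin N → ℝ) → ℂ} {X : Ω → ℂ} (hX : IsStableIntegral α M P f X) {r : ℝ} (hr : 0 < r) :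
    P {ω | r ≤ ‖X ω‖} ≤ ENNReal.ofReal (tailConst α c (r / 3)) *
      (ENNReal.LpAddConst (ENNReal.ofReal α) * eLpNorm f (ENNReal.ofReal α) volume) ^ α := by
  obtain ⟨hf, hXm, s, hs, hsf, hsX⟩ := hX
  rw [tendstoInMeasure_iff_norm] at hsX
  have h3 : 0 < r / 3 := by positivity
  set K := ENNReal.LpAddConst (ENNReal.ofReal α)
  have hK : K ≠ ∞ := (ENNReal.LpAddConst_lt_top _).ne
  have hlim : Tendsto (fun n => P {ω | r / 3 ≤ ‖simpleIntegral M (s n) ω - X ω‖} +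
      ENNReal.ofReal (tailConst α c (r / 3)) *
        (K * (eLpNorm (fun x => s n x - f x) (ENNReal.ofReal α) volume +
          eLpNorm f (ENNReal.ofReal α) volume)) ^ α) atTop
      (𝓝 (0 + ENNReal.ofReal (tailConst α c (r / 3)) *
        (K * (0 + eLpNorm f (ENNReal.ofReal α) volume)) ^ α)) := by
    refine (hsX _ h3).add (ENNReal.Tendsto.const_mul ?_ (Or.inr (by simp)))
    refine (ENNReal.continuous_rpow_const.tendsto _).comp ?_
    exact ENNReal.Tendsto.const_mul (hsf.add tendsto_const_nhds) (Or.inr hK)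
  rw [zero_add, zero_add] at hlim
  refine ge_of_tendsto' hlim fun n => ?_
  have hsub : {ω | r ≤ ‖X ω‖} ⊆ {ω | r / 3 ≤ ‖simpleIntegral M (s n) ω - X ω‖} ∪
      {ω | r / 3 < ‖simpleIntegral M (s n) ω‖} := by
    intro ω hω
    simp only [Set.mem_ofPred_eq, Set.mem_union] at hω ⊢
    by_contra! hcon
    have h4 : ‖X ω‖ ≤ ‖simpleIntegral M (s n) ω‖ + ‖simpleIntegral M (s n) ω - X ω‖ := by
      have := norm_sub_le (simpleIntegral M (s n) ω) (simpleIntegral M (s n) ω - X ω)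
      simpa using this
    linarith [hcon.1, hcon.2]
  refine (measure_mono hsub).trans ((measure_union_le _ _).trans ?_)
  gcongr
  refine (measure_simpleIntegral_gt_le hM hα hc (hs n) h3).trans ?_
  rw [lintegral_enorm_rpow_eq hα]
  gcongr
  have h5 : (s n : (Fin N → ℝ) → ℂ) = (fun x => s n x - f x) + f := by
    funext x
    simp
  conv_lhs => rw [h5]
  exact eLpNorm_add_le' ((s n).stronglyMeasurable.aestronglyMeasurable.sub hf.1) hf.1 _

/-- Continuity of the stochastic integral: convergence in `L^α` of the integrands implies
convergence in probability of the integrals. -/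
lemma tendstoInMeasure_of_isStableIntegral [IsProbabilityMeasure P]
    (hM : IsStableRandomMeasure α c M P) (hα : 0 < α) (hc : 0 < c)
    {f : ℕ → (Fin N → ℝ) → ℂ} {g : (Fin N → ℝ) → ℂ} {X : ℕ → Ω → ℂ} {Y : Ω → ℂ}
    (hX : ∀ n, IsStableIntegral α M P (f n) (X n)) (hY : IsStableIntegral α M P g Y)
    (hfg : Tendsto (fun n => eLpNorm (fun x => f n x - g x) (ENNReal.ofReal α) volume)
      atTop (𝓝 0)) :
    TendstoInMeasure P X atTop Y := by
  rw [tendstoInMeasure_iff_norm]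
  intro ε hε
  have hK : ENNReal.LpAddConst (ENNReal.ofReal α) ≠ ∞ := (ENNReal.LpAddConst_lt_top _).ne
  have h1 := ENNReal.Tendsto.const_mul hfg (Or.inr hK)
  rw [mul_zero] at h1
  refine tendsto_of_tendsto_of_tendsto_of_le_of_le tendsto_const_nhds
    (tendsto_const_mul_rpow_zero h1 hα
      (C := ENNReal.ofReal (tailConst α c (ε / 3))) (by simp)) (fun _ => zero_le) fun n => ?_
  have h2 := ((hX n).linear hM hY 1 (-1)).measure_ge_le hM hα hc hε
  simpa [sub_eq_add_neg] using h2

end StableIntegral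

/-! ### Fourier analysis of the wavelets -/

section Wavelet

lemma exists_schwartz_comp_mul (f : 𝓢(ℝ, ℂ)) {a : ℝ} (ha : a ≠ 0) :
    ∃ g : 𝓢(ℝ, ℂ), ∀ x, g x = f (a * x) :=
  ⟨SchwartzMap.compCLMOfContinuousLinearEquiv ℂ
    (ContinuousLinearEquiv.unitsEquivAut ℝ (Units.mk0 a ha)) f, fun x => by simp [mul_comm]⟩

lemma exists_schwartz_psiJK (ψ : 𝓢(ℝ, ℝ)) (j k : ℤ) :
    ∃ φ : 𝓢(ℝ, ℂ), ∀ x, φ x = psiJK ψ j k x := by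
  obtain ⟨g, hg⟩ := exists_schwartz_comp_mul
    ((SchwartzMap.postcompCLM Complex.ofRealCLM ψ).compSubConstCLM ℂ (k : ℝ))
    (a := (2 : ℝ) ^ j) (by positivity)
  refine ⟨(((2 : ℝ) ^ ((j : ℝ) / 2) : ℝ) : ℂ) • g, fun x => ?_⟩
  simp [hg, psiJK]

/-- Converts angular frequency to the normalization `e^{-2πisu}`, to which the general Fourier
theory applies. -/
lemma fourierHat_eq (g : ℝ → ℂ) (ξ : ℝ) :
    fourierHat g ξ = (((2 * Real.pi) ^ (-(1 / 2 : ℝ)) : ℝ) : ℂ) *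
      FourierTransform.fourier g ((2 * Real.pi)⁻¹ * ξ) := by
  rw [fourierHat, Real.fourier_real_eq_integral_exp_smul]
  congr 1
  refine integral_congr_ae (Eventually.of_forall fun s => ?_)
  simp only [smul_eq_mul]
  congr 2
  have : (Real.pi : ℂ) ≠ 0 := by exact_mod_cast Real.pi_ne_zero
  push_cast
  field_simp

lemma exists_schwartz_fourierHat (φ : 𝓢(ℝ, ℂ)) :
    ∃ g : 𝓢(ℝ, ℂ), ∀ ξ, g ξ = fourierHat φ ξ := by
  obtain ⟨g, hg⟩ := exists_schwartz_comp_mul (FourierTransform.fourier φ)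
    (a := (2 * Real.pi)⁻¹) (by positivity)
  refine ⟨(((2 * Real.pi) ^ (-(1 / 2 : ℝ)) : ℝ) : ℂ) • g, fun ξ => ?_⟩
  rw [fourierHat_eq, smul_apply, hg, smul_eq_mul, SchwartzMap.fourier_coe]

lemma exists_schwartz_fourierHat_ofReal (ψ : 𝓢(ℝ, ℝ)) :
    ∃ g : 𝓢(ℝ, ℂ), ∀ ξ, g ξ = fourierHat (fun x => (ψ x : ℂ)) ξ :=
  exists_schwartz_fourierHat (SchwartzMap.postcompCLM Complex.ofRealCLM ψ)

/-- Substitute `u = 2^j s - k`: the translation contributes only a phase, so the modulus does not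
depend on `k`. -/
lemma fourierHat_psiJK (ψ : ℝ → ℝ) (j k : ℤ) (ξ : ℝ) :
    fourierHat (psiJK ψ j k) ξ = (((2 : ℝ) ^ (-((j : ℝ) / 2)) : ℝ) : ℂ) *
      Complex.exp (-(Complex.I * (k : ℂ) * (((2 : ℝ) ^ (-j) * ξ : ℝ) : ℂ))) *
      fourierHat (fun x => (ψ x : ℂ)) ((2 : ℝ) ^ (-j) * ξ) := by
  have h2 : (0 : ℝ) < 2 ^ j := by positivity
  set G : ℝ → ℂ := fun u => Complex.exp (-(Complex.I * ((u + k : ℝ) : ℂ) *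
    (((2 : ℝ) ^ (-j) * ξ : ℝ) : ℂ))) * (((2 : ℝ) ^ ((j : ℝ) / 2) : ℝ) : ℂ) * (ψ u : ℂ) with hG
  have h1 : ∀ s : ℝ, Complex.exp (-(Complex.I * (s : ℂ) * (ξ : ℂ))) * psiJK ψ j k s =
      G ((2 : ℝ) ^ j * s - k) := by
    intro s
    simp only [hG, psiJK]
    rw [Complex.ofReal_mul, mul_assoc (Complex.exp _)]
    congr 3
    rw [mul_assoc, mul_assoc, ← Complex.ofReal_mul, ← Complex.ofReal_mul]
    congr 2
    rw [zpow_neg]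
    field_simp
    ring
  have h3 : ∫ s : ℝ, G ((2 : ℝ) ^ j * s - k) = (((2 : ℝ) ^ j)⁻¹ : ℝ) * ∫ u, G u := by
    rw [Measure.integral_comp_mul_left (fun u => G (u - k)), integral_sub_right_eq_self,
      abs_of_pos (inv_pos.2 h2), Complex.real_smul]
  have h4 : ∫ u, G u = (((2 : ℝ) ^ ((j : ℝ) / 2) : ℝ) : ℂ) *
      Complex.exp (-(Complex.I * (k : ℂ) * (((2 : ℝ) ^ (-j) * ξ : ℝ) : ℂ))) *
      ∫ u : ℝ, Complex.exp (-(Complex.I * (u : ℂ) * (((2 : ℝ) ^ (-j) * ξ : ℝ) : ℂ))) *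
        (ψ u : ℂ) := by
    rw [← integral_const_mul]
    congr 1
    funext u
    simp only [hG]
    rw [show -(Complex.I * ((u + k : ℝ) : ℂ) * (((2 : ℝ) ^ (-j) * ξ : ℝ) : ℂ)) =
      -(Complex.I * (k : ℂ) * (((2 : ℝ) ^ (-j) * ξ : ℝ) : ℂ)) +
      -(Complex.I * (u : ℂ) * (((2 : ℝ) ^ (-j) * ξ : ℝ) : ℂ)) by push_cast; ring, Complex.exp_add]
    ring
  have h5 : (2 : ℝ) ^ (-((j : ℝ) / 2)) = ((2 : ℝ) ^ j)⁻¹ * (2 : ℝ) ^ ((j : ℝ) / 2) := by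
    rw [← Real.rpow_intCast, ← Real.rpow_neg (by norm_num), ← Real.rpow_add (by norm_num)]
    congr 1
    ring
  rw [fourierHat, fourierHat, integral_congr_ae (Eventually.of_forall h1), h3, h4, h5]
  push_cast
  ring

lemma norm_psiHat (α : ℝ) (ψ : ℝ → ℝ) (j k : ℤ) (ξ : ℝ) :
    ‖psiHat α ψ j k ξ‖ = (2 : ℝ) ^ (-((j : ℝ) * (1 / α))) *
      ‖fourierHat (fun x => (ψ x : ℂ)) ((2 : ℝ) ^ (-j) * ξ)‖ := by
  rw [psiHat, fourierHat_psiJK, norm_mul, norm_mul, norm_mul, Complex.norm_real, Complex.norm_real,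
    Real.norm_of_nonneg (by positivity), Real.norm_of_nonneg (by positivity)]
  have h1 : ‖Complex.exp (-(Complex.I * (k : ℂ) * (((2 : ℝ) ^ (-j) * ξ : ℝ) : ℂ)))‖ = 1 := by
    rw [show -(Complex.I * (k : ℂ) * (((2 : ℝ) ^ (-j) * ξ : ℝ) : ℂ)) =
      Complex.I * ((-(k * ((2 : ℝ) ^ (-j) * ξ)) : ℝ) : ℂ) by push_cast; ring,
      Complex.norm_exp_I_mul_ofReal]
  rw [h1, mul_one, ← mul_assoc, ← Real.rpow_add (by norm_num)]
  congr 2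
  ring

/-- The function `η ↦ ψ̂(η) / |η|^a`, whose inverse Fourier transform is `ψ^v` for
`a = v + 1/α`. -/
def fracHat (ψ : ℝ → ℝ) (a η : ℝ) : ℂ :=
  fourierHat (fun x => (ψ x : ℂ)) η / ((|η| ^ a : ℝ) : ℂ)

/-- The ring is rounded outwards using `3 < π < 3.15`. What matters later is that `2 > 0` and `9 < 2
· 2^3`. -/
lemma IsLemarieMeyer.abs_mem_Icc {ψ : 𝓢(ℝ, ℝ)} (hψ : IsLemarieMeyer ψ) {ξ : ℝ}
    (h : fourierHat (fun x => (ψ x : ℂ)) ξ ≠ 0) : |ξ| ∈ Set.Icc (2 : ℝ) 9 := by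
  have h1 := hψ.support_hat (subset_tsupport _ h)
  simp only [Set.mem_ofPred_eq] at h1
  constructor
  · linarith [Real.pi_gt_three, h1.1]
  · linarith [Real.pi_lt_d2, h1.2]

/-- Division by `|η|^a` preserves smoothness because `ψ̂` vanishes for `|η| < 2`, and the support
stays compact. -/
lemma IsLemarieMeyer.exists_schwartz_fracHat {ψ : 𝓢(ℝ, ℝ)} (hψ : IsLemarieMeyer ψ) (a : ℝ) :
    ∃ g : 𝓢(ℝ, ℂ), ∀ η, g η = fracHat ψ a η := by
  obtain ⟨g, hg⟩ := exists_schwartz_fourierHat_ofReal ψ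
  have hcs : HasCompactSupport (fracHat ψ a) := by
    refine HasCompactSupport.intro (isCompact_Icc (a := (-9 : ℝ)) (b := 9)) fun x hx => ?_
    by_contra hne
    have h1 : fourierHat (fun x => (ψ x : ℂ)) x ≠ 0 := by
      intro h0
      exact hne (by rw [fracHat, h0, zero_div])
    exact hx (abs_le.1 (hψ.abs_mem_Icc h1).2)
  have hsm : ContDiff ℝ (⊤ : ℕ∞) (fracHat ψ a) := by
    rw [contDiff_iff_contDiffAt]
    intro x
    by_cases hx : |x| < 2
    · have h0 : fracHat ψ a =ᶠ[𝓝 x] fun _ => 0 := by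
        filter_upwards [(isOpen_lt continuous_abs continuous_const).mem_nhds hx] with y hy
        have : fourierHat (fun x => (ψ x : ℂ)) y = 0 := by
          by_contra hne
          exact absurd (hψ.abs_mem_Icc hne).1 (not_le.2 hy)
        rw [fracHat, this, zero_div]
      exact contDiffAt_const.congr_of_eventuallyEq h0
    · have hx0 : x ≠ 0 := by
        rintro rfl
        simp at hx
      have h1 : fracHat ψ a = fun η => g η * ((|η| ^ (-a) : ℝ) : ℂ) := by
        funext η
        rw [fracHat, hg, Real.rpow_neg (abs_nonneg η), Complex.ofReal_inv, div_eq_mul_inv]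
      rw [h1]
      refine (g.smooth ⊤).contDiffAt.mul
        (Complex.ofRealCLM.contDiff.contDiffAt.comp x ?_)
      exact (contDiffAt_abs hx0).rpow_const_of_ne (abs_ne_zero.2 hx0)
  exact ⟨hcs.toSchwartzMap hsm, fun η => rfl⟩

lemma IsLemarieMeyer.exists_schwartz_psiFrac {ψ : 𝓢(ℝ, ℝ)} (hψ : IsLemarieMeyer ψ) (α v : ℝ) :
    ∃ Θ : 𝓢(ℝ, ℂ), ∀ y, Θ y = psiFrac α ψ v y := by
  obtain ⟨g, hg⟩ := hψ.exists_schwartz_fracHat (v + 1 / α)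
  obtain ⟨Θ, hΘ⟩ := exists_schwartz_comp_mul (FourierTransformInv.fourierInv g)
    (a := (2 * Real.pi)⁻¹) (by positivity)
  refine ⟨Θ, fun y => ?_⟩
  rw [hΘ, SchwartzMap.fourierInv_coe, Real.fourierInv_eq', psiFrac]
  refine integral_congr_ae (Eventually.of_forall fun η => ?_)
  simp only [smul_eq_mul, hg, fracHat]
  congr 2
  have : (Real.pi : ℂ) ≠ 0 := by exact_mod_cast Real.pi_ne_zero
  simp only [RCLike.inner_apply, conj_trivial]
  push_cast
  field_simp

/-- Substitute `ξ = 2^j η`. The phase `e^{-ikη}` shifts both arguments of `ψ^v` by `-k`, and the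
exponents `j(1/α - 1/2)`, `j`, `-j/2`, `-j(v + 1/α)` add up to `-jv`. -/
lemma IsLemarieMeyer.wCoeff_eq {ψ : 𝓢(ℝ, ℝ)} (hψ : IsLemarieMeyer ψ) (α v : ℝ) (j k : ℤ)
    (x : ℝ) : wCoeff α ψ v j k x = (((2 : ℝ) ^ (-((j : ℝ) * v)) : ℝ) : ℂ) *
      (psiFrac α ψ v ((2 : ℝ) ^ j * x - k) - psiFrac α ψ v (-(k : ℝ))) := by
  obtain ⟨g, hg⟩ := hψ.exists_schwartz_fracHat (v + 1 / α)
  have hint : ∀ y : ℝ, Integrable (fun η : ℝ =>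
      Complex.exp (Complex.I * (y : ℂ) * (η : ℂ)) * fracHat ψ (v + 1 / α) η) := by
    intro y
    have h := g.integrable (μ := volume)
    rw [show (g : ℝ → ℂ) = fracHat ψ (v + 1 / α) from funext hg] at h
    refine h.bdd_mul (c := 1) (by fun_prop) (Eventually.of_forall fun η => ?_)
    rw [mul_assoc, ← Complex.ofReal_mul, Complex.norm_exp_I_mul_ofReal]
  have h2 : (0 : ℝ) < 2 ^ j := by positivity
  have h3 := Measure.integral_comp_mul_left
    (fun ξ => fKer α v x ξ * fourierHat (psiJK ψ j k) ξ) ((2 : ℝ) ^ j)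
  rw [abs_of_pos (inv_pos.2 h2), Complex.real_smul] at h3
  have h4 : ∫ ξ : ℝ, fKer α v x ξ * fourierHat (psiJK ψ j k) ξ = (((2 : ℝ) ^ j : ℝ) : ℂ) *
      ∫ η : ℝ, fKer α v x ((2 : ℝ) ^ j * η) * fourierHat (psiJK ψ j k) ((2 : ℝ) ^ j * η) := by
    rw [h3, ← mul_assoc, ← Complex.ofReal_mul, mul_inv_cancel₀ h2.ne', Complex.ofReal_one, one_mul]
  have h5 : ∀ η : ℝ, fKer α v x ((2 : ℝ) ^ j * η) * fourierHat (psiJK ψ j k) ((2 : ℝ) ^ j * η) =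
      (((2 : ℝ) ^ (-((j : ℝ) / 2)) * (2 : ℝ) ^ (-((j : ℝ) * (v + 1 / α))) : ℝ) : ℂ) *
      (Complex.exp (Complex.I * (((2 : ℝ) ^ j * x - k : ℝ) : ℂ) * (η : ℂ)) *
        fracHat ψ (v + 1 / α) η -
      Complex.exp (Complex.I * ((-(k : ℝ) : ℝ) : ℂ) * (η : ℂ)) * fracHat ψ (v + 1 / α) η) := by
    intro η
    have hη : (2 : ℝ) ^ (-j) * ((2 : ℝ) ^ j * η) = η := by
      rw [zpow_neg, inv_mul_cancel_left₀ h2.ne']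
    rw [fourierHat_psiJK, hη, fKer, fracHat, abs_mul, abs_of_pos h2,
      Real.mul_rpow h2.le (abs_nonneg _), ← Real.rpow_intCast, ← Real.rpow_mul (by norm_num),
      Real.rpow_neg (by norm_num) ((j : ℝ) * (v + 1 / α))]
    have he : Complex.exp (Complex.I * ((((2 : ℝ) ^ (j : ℝ)) * x - k : ℝ) : ℂ) * (η : ℂ)) =
        Complex.exp (Complex.I * (x : ℂ) * ((((2 : ℝ) ^ (j : ℝ)) * η : ℝ) : ℂ)) *
          Complex.exp (-(Complex.I * (k : ℂ) * (η : ℂ))) := by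
      rw [← Complex.exp_add]
      congr 1
      push_cast
      ring
    have he2 : Complex.exp (Complex.I * ((-(k : ℝ) : ℝ) : ℂ) * (η : ℂ)) =
        Complex.exp (-(Complex.I * (k : ℂ) * (η : ℂ))) := by
      congr 1
      push_cast
      ring
    rw [he, he2]
    push_cast
    field_simp
  rw [wCoeff, h4, integral_congr_ae (Eventually.of_forall h5), integral_const_mul,
    integral_sub (hint _) (hint _), psiFrac, psiFrac]
  simp only [fracHat]
  rw [← mul_assoc, ← mul_assoc, ← Complex.ofReal_mul, ← Complex.ofReal_mul]
  congr 2
  rw [← Real.rpow_intCast, ← Real.rpow_add (by norm_num), ← Real.rpow_add (by norm_num),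
    ← Real.rpow_add (by norm_num)]
  congr 1
  ring

end Wavelet

/-! ### Absolute convergence of the one-dimensional wavelet series -/

section Domination

lemma exists_schwartz_decay (Θ : 𝓢(ℝ, ℂ)) :
    ∃ C : ℝ, 0 ≤ C ∧ ∀ x, ‖Θ x‖ ≤ C * (1 / (1 + |x|) ^ 2) := by
  refine ⟨2 ^ 2 * (Finset.Iic ((2, 0) : ℕ × ℕ)).sup
    (fun m => SchwartzMap.seminorm ℝ m.1 m.2) Θ, by positivity, fun x => ?_⟩
  have h := SchwartzMap.one_add_le_sup_seminorm_apply (𝕜 := ℝ) (m := (2, 0)) (k := 2) (n := 0)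
    le_rfl le_rfl Θ x
  rw [norm_iteratedFDeriv_zero, Real.norm_eq_abs] at h
  rw [mul_one_div, le_div_iff₀ (by positivity), mul_comm]
  exact h

/-- For `|x| ≥ 1` the two values are bounded separately; for `|x| ≤ 1` the mean value inequality
gains the factor `|x|`. That gain later controls the low frequencies. -/
lemma exists_schwartz_increment_le (Θ : 𝓢(ℝ, ℂ)) :
    ∃ C : ℝ, 0 ≤ C ∧ ∀ x k : ℝ, ‖Θ (x - k) - Θ (-k)‖ ≤
      C * min 1 |x| * (1 / (1 + |x - k|) ^ 2 + 1 / (1 + |k|) ^ 2) := by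
  obtain ⟨C, hC, h⟩ := exists_schwartz_decay Θ
  obtain ⟨C', hC', h'⟩ := exists_schwartz_decay (SchwartzMap.derivCLM ℝ ℂ Θ)
  refine ⟨C + 4 * C', by positivity, fun x k => ?_⟩
  have hq1 : 0 ≤ 1 / (1 + |x - k|) ^ 2 := by positivity
  have hq2 : 0 ≤ 1 / (1 + |k|) ^ 2 := by positivity
  rcases le_total 1 |x| with hx | hx
  · rw [min_eq_left hx, mul_one]
    have h1 := norm_sub_le (Θ (x - k)) (Θ (-k))
    have h2 := h (x - k)
    have h3 := h (-k)
    rw [abs_neg] at h3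
    nlinarith [mul_nonneg hC' hq1, mul_nonneg hC' hq2]
  · rw [min_eq_right hx]
    have hb : ∀ y ∈ Metric.closedBall (-k) |x|, ‖deriv Θ y‖ ≤ 4 * C' * (1 / (1 + |k|) ^ 2) := by
      intro y hy
      refine (h' y).trans ?_
      rw [Metric.mem_closedBall, Real.dist_eq] at hy
      have h1 : |k| ≤ |y| + 1 := by
        have := abs_sub_abs_le_abs_sub k (-y)
        rw [abs_neg, sub_neg_eq_add] at this
        rw [sub_neg_eq_add, add_comm y k] at hy
        linarith
      -- On the ball `|k| ≤ |y| + 1`, so `1 + |k| ≤ 2(1 + |y|)`; squaring gives the `4`.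
      have h2 : (1 + |k|) ^ 2 ≤ 4 * (1 + |y|) ^ 2 := by
        nlinarith [abs_nonneg k, abs_nonneg y]
      rw [mul_one_div, mul_one_div, div_le_div_iff₀ (by positivity) (by positivity)]
      nlinarith
    have h1 := (convex_closedBall (-k) |x|).norm_image_sub_le_of_norm_deriv_le
      (fun y _ => Θ.differentiableAt) hb (Metric.mem_closedBall_self (abs_nonneg x))
      (y := x - k) (by rw [Metric.mem_closedBall, Real.dist_eq]; simp)
    rw [show x - k - -k = x by ring, Real.norm_eq_abs] at h1
    refine h1.trans ?_
    have hx0 := abs_nonneg x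
    nlinarith [mul_nonneg (mul_nonneg hC hx0) hq1, mul_nonneg (mul_nonneg hC hx0) hq2,
      mul_nonneg (mul_nonneg hC' hx0) hq1]

lemma summable_int_one_div_sq : Summable fun k : ℤ => 1 / (1 + |(k : ℝ)|) ^ 2 := by
  have h : Summable fun n : ℕ => 1 / (1 + (n : ℝ)) ^ 2 := by
    have := (summable_nat_add_iff 1).2 (Real.summable_one_div_nat_pow (p := 2).2 (by norm_num))
    refine this.congr fun n => ?_
    push_cast
    rw [add_comm]
  refine Summable.of_nat_of_neg ?_ ?_
  · simpa using h
  · simpa using h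

/-- Shifting the index by `⌊x⌋` reduces to `x ∈ [0, 1)`, which makes the bound uniform in `x`. -/
lemma exists_tsum_int_le :
    ∃ B : ℝ≥0∞, B ≠ ∞ ∧ ∀ x : ℝ, ∑' k : ℤ, ENNReal.ofReal (1 / (1 + |x - k|) ^ 2) ≤ B := by
  refine ⟨∑' k : ℤ, ENNReal.ofReal (4 * (1 / (1 + |(k : ℝ)|) ^ 2)),
    (summable_int_one_div_sq.mul_left 4).tsum_ofReal_ne_top, fun x => ?_⟩
  rw [← (Equiv.addRight ⌊x⌋).tsum_eq]
  refine ENNReal.tsum_le_tsum fun k => ENNReal.ofReal_le_ofReal ?_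
  rw [mul_one_div, div_le_div_iff₀ (by positivity) (by positivity)]
  simp only [Equiv.coe_addRight]
  push_cast
  have h1 := Int.floor_le x
  have h2 := (Int.lt_floor_add_one x).le
  have h3 : |(k : ℝ)| ≤ |x - (k + ⌊x⌋)| + 1 := by
    have h4 := abs_sub_abs_le_abs_sub (k : ℝ) (k - (x - ⌊x⌋))
    rw [show (k : ℝ) - (k - (x - ⌊x⌋)) = x - ⌊x⌋ by ring, abs_of_nonneg (sub_nonneg.2 h1),
      abs_sub_comm (k : ℝ)] at h4
    rw [show x - ((k : ℝ) + ⌊x⌋) = x - ⌊x⌋ - k by ring]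
    linarith
  nlinarith [abs_nonneg (k : ℝ), abs_nonneg (x - (k + ⌊x⌋))]

/-- The dominating function `ξ ↦ |ξ|^{-a} min(1, |ξ|)`. -/
def domFun (a ξ : ℝ) : ℝ := |ξ| ^ (-a) * min 1 |ξ|

lemma domFun_nonneg (a ξ : ℝ) : 0 ≤ domFun a ξ := by unfold domFun; positivity

lemma zpow_le_of_mem_Icc {ξ : ℝ} {j : ℤ} (h : |(2 : ℝ) ^ (-j) * ξ| ∈ Set.Icc (2 : ℝ) 9) :
    2 * (2 : ℝ) ^ j ≤ |ξ| ∧ |ξ| ≤ 9 * (2 : ℝ) ^ j := by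
  have h2 : (0 : ℝ) < 2 ^ j := by positivity
  rw [abs_mul, zpow_neg, abs_of_pos (inv_pos.2 h2), inv_mul_eq_div] at h
  exact ⟨(le_div_iff₀ h2).1 h.1, (div_le_iff₀ h2).1 h.2⟩

/-- If scales `i` and `j ≥ i + 3` were both active, then `16 · 2^i ≤ 2 · 2^j ≤ |ξ| ≤ 9 · 2^i`.
Active scales thus lie within distance `2` of any one of them, which leaves at most five. -/
lemma tsum_indicator_scales_le (ξ : ℝ) (A : ℝ≥0∞) :
    ∑' j : ℤ, Set.indicator {j : ℤ | |(2 : ℝ) ^ (-j) * ξ| ∈ Set.Icc (2 : ℝ) 9}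
      (fun _ => A) j ≤ 5 * A := by
  set S := {j : ℤ | |(2 : ℝ) ^ (-j) * ξ| ∈ Set.Icc (2 : ℝ) 9} with hS
  have hclose : ∀ i ∈ S, ∀ j ∈ S, j ≤ i + 2 := by
    intro i hi j hj
    by_contra! hlt
    have h1 := zpow_le_of_mem_Icc hi
    have h2 := zpow_le_of_mem_Icc hj
    have h3 : (2 : ℝ) ^ (i + 3) ≤ 2 ^ j := zpow_le_zpow_right₀ (by norm_num) (by omega)
    rw [zpow_add₀ (by norm_num)] at h3
    have h4 : (0 : ℝ) < 2 ^ i := by positivity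
    norm_num at h3
    linarith [h1.2, h2.1]
  rcases S.eq_empty_or_nonempty with h0 | ⟨i, hi⟩
  · simp [h0]
  · rw [tsum_eq_sum (s := Finset.Icc (i - 2) (i + 2))]
    · refine (Finset.sum_le_sum fun j _ => Set.indicator_le_self' (by simp) j).trans ?_
      rw [Finset.sum_const, Int.card_Icc, nsmul_eq_mul]
      gcongr
      rw [show i + 2 + 1 - (i - 2) = 5 by ring]
      norm_num
    · intro j hj
      refine Set.indicator_of_notMem (fun hjS => hj ?_) _
      have h1 := hclose i hi j hjS
      have h2 := hclose j hjS i hi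
      rw [Finset.mem_Icc]
      omega

/-- The one-dimensional wavelet series is absolutely convergent and dominated. -/
lemma IsLemarieMeyer.exists_tsum_le {ψ : 𝓢(ℝ, ℝ)} (hψ : IsLemarieMeyer ψ) {α v : ℝ}
    (hα : 0 < α) (hv : 0 < v) (t : ℝ) :
    ∃ C : ℝ, 0 ≤ C ∧ ∀ ξ, ∑' p : ℤ × ℤ,
      ‖wCoeff α ψ v p.1 p.2 t * conj (psiHat α ψ p.1 p.2 ξ)‖ₑ ≤
        ENNReal.ofReal (C * domFun (v + 1 / α) ξ) := by
  obtain ⟨Θ, hΘ⟩ := hψ.exists_schwartz_psiFrac α v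
  obtain ⟨C₁, hC₁, hinc⟩ := exists_schwartz_increment_le Θ
  obtain ⟨g, hg⟩ := exists_schwartz_fourierHat_ofReal ψ
  obtain ⟨C₂, hC₂, hdec⟩ := exists_schwartz_decay g
  obtain ⟨B, hB, hsum⟩ := exists_tsum_int_le
  set a := v + 1 / α with ha
  have ha0 : 0 < a := by positivity
  set A : ℝ := C₁ * (1 + |t|) * C₂ * 9 ^ a with hA
  have hA0 : 0 ≤ A := by positivity
  set q : ℝ → ℝ := fun u => 1 / (1 + |u|) ^ 2 with hq
  have hq0 : ∀ u, 0 ≤ q u := fun u => by positivity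
  -- Five active scales, each with two sums over `k` bounded by `B`.
  refine ⟨A * (5 * (B + B)).toReal, by positivity, fun ξ => ?_⟩
  set S := {j : ℤ | |(2 : ℝ) ^ (-j) * ξ| ∈ Set.Icc (2 : ℝ) 9} with hS
  -- The second weight is written at `0 - k` so that the uniform bound `hsum` covers both sums.
  have hterm : ∀ j k : ℤ, ‖wCoeff α ψ v j k t * conj (psiHat α ψ j k ξ)‖ₑ ≤
      S.indicator (fun _ => ENNReal.ofReal (A * domFun a ξ)) j *
        (ENNReal.ofReal (q ((2 : ℝ) ^ j * t - k)) + ENNReal.ofReal (q (0 - k))) := by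
    intro j k
    by_cases hj : j ∈ S
    · rw [Set.indicator_of_mem hj, ← ENNReal.ofReal_add (hq0 _) (hq0 _),
        ← ENNReal.ofReal_mul (mul_nonneg hA0 (domFun_nonneg _ _)), ← ofReal_norm]
      refine ENNReal.ofReal_le_ofReal ?_
      have h2 : (0 : ℝ) < 2 ^ j := by positivity
      obtain ⟨hlo, hhi⟩ := zpow_le_of_mem_Icc hj
      have hξ : 0 < |ξ| := lt_of_lt_of_le (by positivity) hlo
      have h1 := hinc ((2 : ℝ) ^ j * t) k
      rw [hΘ, hΘ] at h1
      have hψb : ‖fourierHat (fun x => (ψ x : ℂ)) ((2 : ℝ) ^ (-j) * ξ)‖ ≤ C₂ := by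
        rw [← hg]
        refine (hdec _).trans (mul_le_of_le_one_right hC₂ ?_)
        rw [div_le_one (by positivity)]
        nlinarith [abs_nonneg ((2 : ℝ) ^ (-j) * ξ)]
      -- On an active scale `2^j ≤ |ξ| / 2`, which turns smallness in `2^j` into smallness in `|ξ|`.
      have hmin : min 1 |(2 : ℝ) ^ j * t| ≤ (1 + |t|) * min 1 |ξ| := by
        rw [abs_mul, abs_of_pos h2]
        have ht := abs_nonneg t
        rcases le_total 1 |ξ| with h | h
        · rw [min_eq_left h]
          exact (min_le_left _ _).trans (by linarith)
        · rw [min_eq_right h]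
          refine (min_le_right _ _).trans ?_
          nlinarith
      -- The left side is `2^{-ja}`, and `|ξ| ≤ 9 · 2^j` costs the factor `9^a`.
      have hpow : (2 : ℝ) ^ (-((j : ℝ) * v)) * (2 : ℝ) ^ (-((j : ℝ) * (1 / α))) ≤
          9 ^ a * |ξ| ^ (-a) := by
        rw [← Real.rpow_add (by norm_num), show -((j : ℝ) * v) + -((j : ℝ) * (1 / α)) =
          (j : ℝ) * (-a) by rw [ha]; ring, Real.rpow_mul (by norm_num), Real.rpow_intCast,
          Real.rpow_neg h2.le, Real.rpow_neg hξ.le, ← div_eq_mul_inv, le_div_iff₀ (by positivity),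
          inv_mul_le_iff₀ (by positivity), ← Real.mul_rpow h2.le (by norm_num)]
        exact Real.rpow_le_rpow hξ.le (by linarith) ha0.le
      rw [norm_mul, Complex.norm_conj, norm_psiHat, hψ.wCoeff_eq, norm_mul, Complex.norm_real,
        Real.norm_of_nonneg (by positivity)]
      calc (2 : ℝ) ^ (-((j : ℝ) * v)) *
            ‖psiFrac α ψ v ((2 : ℝ) ^ j * t - k) - psiFrac α ψ v (-(k : ℝ))‖ *
            ((2 : ℝ) ^ (-((j : ℝ) * (1 / α))) *
              ‖fourierHat (fun x => (ψ x : ℂ)) ((2 : ℝ) ^ (-j) * ξ)‖)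
          = ((2 : ℝ) ^ (-((j : ℝ) * v)) * (2 : ℝ) ^ (-((j : ℝ) * (1 / α)))) *
            ‖psiFrac α ψ v ((2 : ℝ) ^ j * t - k) - psiFrac α ψ v (-(k : ℝ))‖ *
              ‖fourierHat (fun x => (ψ x : ℂ)) ((2 : ℝ) ^ (-j) * ξ)‖ := by ring
        _ ≤ (9 ^ a * |ξ| ^ (-a)) * (C₁ * ((1 + |t|) * min 1 |ξ|) *
            (q ((2 : ℝ) ^ j * t - k) + q (0 - k))) * C₂ := by
          gcongr
          refine h1.trans ?_
          rw [hq]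
          simp only [zero_sub, abs_neg]
          gcongr
        _ = A * domFun a ξ * (q ((2 : ℝ) ^ j * t - k) + q (0 - k)) := by
          rw [hA, domFun]
          ring
    · have h0 : fourierHat (fun x => (ψ x : ℂ)) ((2 : ℝ) ^ (-j) * ξ) = 0 := by
        by_contra hne
        exact hj (hψ.abs_mem_Icc hne)
      have h1 : psiHat α ψ j k ξ = 0 := by
        rw [← norm_eq_zero, norm_psiHat, h0, norm_zero, mul_zero]
      simp [h1]
  rw [ENNReal.tsum_prod
    (f := fun j k => ‖wCoeff α ψ v j k t * conj (psiHat α ψ j k ξ)‖ₑ)]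
  calc ∑' (j : ℤ) (k : ℤ), ‖wCoeff α ψ v j k t * conj (psiHat α ψ j k ξ)‖ₑ
      ≤ ∑' j : ℤ, S.indicator (fun _ => ENNReal.ofReal (A * domFun a ξ)) j * (B + B) := by
        refine ENNReal.tsum_le_tsum fun j => (ENNReal.tsum_le_tsum (hterm j)).trans ?_
        rw [ENNReal.tsum_mul_left, ENNReal.tsum_add]
        gcongr
        · exact hsum _
        · exact hsum _
    _ ≤ 5 * ENNReal.ofReal (A * domFun a ξ) * (B + B) := by
        rw [ENNReal.tsum_mul_right]
        gcongr
        exact tsum_indicator_scales_le ξ _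
    _ = ENNReal.ofReal (A * (5 * (B + B)).toReal * domFun a ξ) := by
        have hB5 : 5 * (B + B) ≠ ∞ := ENNReal.mul_ne_top (by simp) (by simp [hB])
        rw [show A * (5 * (B + B)).toReal * domFun a ξ =
          A * domFun a ξ * (5 * (B + B)).toReal by ring,
          ENNReal.ofReal_mul (mul_nonneg hA0 (domFun_nonneg _ _)), ENNReal.ofReal_toReal hB5]
        ring

lemma norm_exp_sub_one_le_min (x ξ : ℝ) :
    ‖Complex.exp (Complex.I * (x : ℂ) * (ξ : ℂ)) - 1‖ ≤ (2 + |x|) * min 1 |ξ| := by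
  rw [mul_assoc, ← Complex.ofReal_mul]
  have hx := abs_nonneg x
  rcases le_total 1 |ξ| with h | h
  · rw [min_eq_left h]
    refine (norm_sub_le _ _).trans ?_
    rw [Complex.norm_exp_I_mul_ofReal, norm_one]
    linarith
  · rw [min_eq_right h]
    refine Real.norm_exp_I_mul_ofReal_sub_one_le.trans ?_
    rw [Real.norm_eq_abs, abs_mul]
    nlinarith [abs_nonneg ξ]

lemma norm_fKer_le (α v x ξ : ℝ) :
    ‖fKer α v x ξ‖ ≤ (2 + |x|) * domFun (v + 1 / α) ξ := by
  rw [fKer, norm_div, Complex.norm_real, Real.norm_of_nonneg (by positivity), domFun,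
    Real.rpow_neg (abs_nonneg ξ), div_eq_mul_inv]
  calc _ ≤ ((2 + |x|) * min 1 |ξ|) * (|ξ| ^ (v + 1 / α))⁻¹ := by
        gcongr
        exact norm_exp_sub_one_le_min x ξ
    _ = _ := by ring

lemma measurable_fKer (α v x : ℝ) : Measurable (fKer α v x) := by unfold fKer; fun_prop

lemma integrable_comp_abs {f : ℝ → ℝ} (hf : IntegrableOn f (Set.Ioi 0)) :
    Integrable fun x => f |x| := by
  have h1 : IntegrableOn (fun x => f |x|) (Set.Ioi 0) :=
    hf.congr_fun (fun x hx => by rw [abs_of_pos hx]) measurableSet_Ioi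
  have h2 : IntegrableOn (fun x => f |x|) (Set.Iio 0) := by
    have := h1.comp_neg
    simpa using this
  have h3 : IntegrableOn (fun x => f |x|) (Set.Iic 0) := by
    rwa [integrableOn_Iic_iff_integrableOn_Iio]
  rw [← integrableOn_univ, ← Set.Iic_union_Ioi (a := (0 : ℝ))]
  exact h3.union h1

/-- The integrand is `|ξ|^{α(1-v)-1}` near zero and `|ξ|^{-αv-1}` at infinity, so `v < 1` and `v >
0` give integrability at the two ends. -/
lemma integrable_domFun_rpow {α v : ℝ} (hα : 0 < α) (hv0 : 0 < v) (hv1 : v < 1) :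
    Integrable fun ξ => domFun (v + 1 / α) ξ ^ α := by
  have h1 : 0 < α * v := by positivity
  have h2 : 0 < α * (1 - v) := mul_pos hα (by linarith)
  have hα1 : 1 / α * α = 1 := one_div_mul_cancel hα.ne'
  refine integrable_comp_abs (f := fun u => (u ^ (-(v + 1 / α)) * min 1 u) ^ α) ?_
  rw [← Set.Ioc_union_Ioi_eq_Ioi (zero_le_one (α := ℝ))]
  refine IntegrableOn.union ?_ ?_
  · have h := intervalIntegral.intervalIntegrable_rpow' (a := 0) (b := 1)
      (r := (1 - (v + 1 / α)) * α) (by nlinarith)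
    rw [intervalIntegrable_iff_integrableOn_Ioc_of_le zero_le_one] at h
    refine h.congr_fun (fun u hu => ?_) measurableSet_Ioc
    simp only
    rw [min_eq_right hu.2, Real.rpow_mul hu.1.le]
    congr 1
    nth_rw 3 [← Real.rpow_one u]
    rw [← Real.rpow_add hu.1]
    congr 1
    ring
  · have h := integrableOn_Ioi_rpow_of_lt (a := -(v + 1 / α) * α) (c := 1) (by nlinarith)
      one_pos
    refine h.congr_fun (fun u hu => ?_) measurableSet_Ioi
    have hu' : (1 : ℝ) < u := hu
    simp only
    rw [min_eq_left hu'.le, mul_one, Real.rpow_mul (by linarith)]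

end Domination

/-! ### Pointwise identification of the one-dimensional wavelet series -/

section Expansion

lemma quasiMeasurePreserving_mul_left {a : ℝ} (ha : a ≠ 0) :
    Measure.QuasiMeasurePreserving (fun x : ℝ => a * x) volume volume := by
  refine ⟨by fun_prop, ?_⟩
  rw [Real.map_volume_mul_left ha]
  exact Measure.smul_absolutelyContinuous

lemma memLp_comp_mul_left {F : ℝ → ℂ} {p : ℝ≥0∞} (hF : MemLp F p volume) {a : ℝ} (ha : a ≠ 0) :
    MemLp (fun x => F (a * x)) p volume := by
  refine MemLp.comp_of_map (f := fun x => a * x) ?_ (by fun_prop)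
  rw [Real.map_volume_mul_left ha]
  exact hF.smul_measure (by simp)

lemma hasSum_inner_smul_isometry {ι E : Type*} [NormedAddCommGroup E] [InnerProductSpace ℂ E]
    (b : HilbertBasis ι ℂ E) (U : E ≃ₗᵢ[ℂ] E) (g : E) :
    HasSum (fun i => inner ℂ (U (b i)) g • U (b i)) g := by
  have h := (b.hasSum_repr (U.symm g)).mapL (U.toContinuousLinearEquiv : E →L[ℂ] E)
  simp only [b.repr_apply_apply] at h
  have h1 : ∀ i, inner ℂ (U (b i)) g = inner ℂ (b i) (U.symm g) := fun i => by
    rw [← U.inner_map_map (b i), U.apply_symm_apply]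
  simpa [h1] using h

/-- The `L²` expansion in the conjugated Fourier transforms of the wavelets, along a sequence of
finite index sets for which it converges almost everywhere. -/
lemma IsLemarieMeyer.exists_seq_tendsto_ae {ψ : 𝓢(ℝ, ℝ)} (hψ : IsLemarieMeyer ψ) {F : ℝ → ℂ}
    (hF : MemLp F 2 volume) :
    ∃ ns : ℕ → Finset (ℤ × ℤ), Tendsto ns atTop atTop ∧ ∀ᵐ ξ, Tendsto (fun n =>
      ∑ p ∈ ns n, (∫ η, F η * fourierHat (psiJK ψ p.1 p.2) η) *
        conj (fourierHat (psiJK ψ p.1 p.2) ξ)) atTop (𝓝 (F ξ)) := by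
  obtain ⟨b, hb⟩ := hψ.orthonormal_basis
  choose φ hφ using exists_schwartz_psiJK ψ
  have hbφ : ∀ p : ℤ × ℤ, b p = (φ p.1 p.2).toLp 2 := by
    intro p
    refine Lp.ext ((hb p.1 p.2).trans ?_)
    filter_upwards [(φ p.1 p.2).coeFn_toLp 2 volume] with x hx
    rw [hx, hφ]
  have hpi : (0 : ℝ) < 2 * Real.pi := by positivity
  -- `κ = √(2π)` reconciles the two unitary normalizations of the Fourier transform.
  set κ : ℝ := (2 * Real.pi) ^ (1 / 2 : ℝ) with hκ
  have hκκ : κ * κ = 2 * Real.pi := by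
    rw [hκ, ← Real.rpow_add hpi]
    norm_num
  have hκ0 : 0 < κ := by positivity
  have hfour : ∀ (p : ℤ × ℤ) (u : ℝ), FourierTransform.fourier (φ p.1 p.2) u =
      (κ : ℂ) * fourierHat (psiJK ψ p.1 p.2) (2 * Real.pi * u) := by
    intro p u
    rw [fourierHat_eq, inv_mul_cancel_left₀ hpi.ne', ← mul_assoc, ← Complex.ofReal_mul,
      Real.rpow_neg hpi.le, mul_inv_cancel₀ hκ0.ne', Complex.ofReal_one, one_mul,
      SchwartzMap.fourier_coe, funext (hφ p.1 p.2)]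
  -- Expanding the conjugate of `F` and conjugating back yields coefficients `∫ F ψ̂_{j,k}` without
  -- conjugation, against conjugated wavelets.
  have hG : MemLp (fun u => conj (F (2 * Real.pi * u))) 2 volume := by
    have h := memLp_comp_mul_left hF hpi.ne'
    exact h.congr_norm (Complex.continuous_conj.comp_aestronglyMeasurable h.1)
      (Eventually.of_forall fun u => by simp)
  set g := hG.toLp
  set U := Lp.fourierTransformₗᵢ ℝ ℂ
  have hU : ∀ p : ℤ × ℤ, (U (b p) : ℝ → ℂ) =ᵐ[volume]
      fun u => (κ : ℂ) * fourierHat (psiJK ψ p.1 p.2) (2 * Real.pi * u) := by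
    intro p
    have h : U (b p) = (FourierTransform.fourier (φ p.1 p.2)).toLp 2 := by
      rw [hbφ]
      exact SchwartzMap.toLp_fourier_eq (φ p.1 p.2)
    rw [h]
    filter_upwards [(FourierTransform.fourier (φ p.1 p.2)).coeFn_toLp 2 volume] with u hu
    rw [hu, hfour]
  set cf : ℤ × ℤ → ℂ := fun p => ∫ η, F η * fourierHat (psiJK ψ p.1 p.2) η
  have hinner : ∀ p : ℤ × ℤ, inner ℂ (U (b p)) g = (κ : ℂ)⁻¹ * conj (cf p) := by
    intro p
    rw [L2.inner_def]
    have h1 : ∫ u, inner ℂ ((U (b p) : ℝ → ℂ) u) ((g : ℝ → ℂ) u) = ∫ u, (κ : ℂ) *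
        conj (F (2 * Real.pi * u) * fourierHat (psiJK ψ p.1 p.2) (2 * Real.pi * u)) := by
      refine integral_congr_ae ?_
      filter_upwards [hU p, hG.coeFn_toLp] with u hu1 hu2
      rw [hu1, hu2, RCLike.inner_apply]
      simp only [map_mul, Complex.conj_ofReal]
      ring
    rw [h1, integral_const_mul, integral_conj, Measure.integral_comp_mul_left
      (fun ξ => F ξ * fourierHat (psiJK ψ p.1 p.2) ξ), abs_of_pos (inv_pos.2 hpi),
      Complex.real_smul, map_mul, Complex.conj_ofReal, ← hκκ]
    have : (κ : ℂ) ≠ 0 := by exact_mod_cast hκ0.ne'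
    push_cast
    field_simp
    rfl
  have hsum := hasSum_inner_smul_isometry b U g
  obtain ⟨ns, hns, hae⟩ := (tendstoInMeasure_of_tendsto_Lp (p := 2) hsum).exists_seq_tendsto_ae'
  refine ⟨ns, hns, ?_⟩
  have hae2 : ∀ᵐ u : ℝ, Tendsto (fun n => ∑ p ∈ ns n, cf p *
      conj (fourierHat (psiJK ψ p.1 p.2) (2 * Real.pi * u))) atTop (𝓝 (F (2 * Real.pi * u))) := by
    have hsm : ∀ᵐ u : ℝ, ∀ p : ℤ × ℤ, ((inner ℂ (U (b p)) g • U (b p) : Lp ℂ 2) : ℝ → ℂ) u =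
        inner ℂ (U (b p)) g * (U (b p) : ℝ → ℂ) u :=
      ae_all_iff.2 fun p => by
        filter_upwards [Lp.coeFn_smul (inner ℂ (U (b p)) g) (U (b p))] with u hu
        rw [hu]
        rfl
    have hfs : ∀ᵐ u : ℝ, ∀ n, ((∑ p ∈ ns n, inner ℂ (U (b p)) g • U (b p) : Lp ℂ 2) : ℝ → ℂ) u =
        ∑ p ∈ ns n, ((inner ℂ (U (b p)) g • U (b p) : Lp ℂ 2) : ℝ → ℂ) u :=
      ae_all_iff.2 fun n => by
        filter_upwards [Lp.coeFn_finsetSum (ns n) fun p => inner ℂ (U (b p)) g • U (b p)] with u hu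
        rw [hu, Finset.sum_apply]
    filter_upwards [hae, hsm, hfs, ae_all_iff.2 hU, hG.coeFn_toLp] with u h1 h2 h3 h4 h5
    rw [h5] at h1
    have h6 := (Complex.continuous_conj.tendsto _).comp h1
    rw [Complex.conj_conj] at h6
    refine h6.congr fun n => ?_
    simp only [Function.comp]
    rw [h3, map_sum]
    refine Finset.sum_congr rfl fun p _ => ?_
    rw [h2, h4, hinner]
    have : (κ : ℂ) ≠ 0 := by exact_mod_cast hκ0.ne'
    simp only [map_mul, map_inv₀, Complex.conj_conj, Complex.conj_ofReal]
    field_simp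
  have h7 := (quasiMeasurePreserving_mul_left (inv_ne_zero hpi.ne')).ae hae2
  filter_upwards [h7] with ξ hξ
  simpa only [mul_inv_cancel_left₀ hpi.ne'] using hξ

/-- From `α < 2` one gets `2(v + 1/α) > 1`, hence square integrability at infinity. The cutoff is
needed because for small `α` the singularity at zero need not be square integrable. -/
lemma memLp_two_indicator_fKer {α v : ℝ} (hα0 : 0 < α) (hα2 : α < 2) (hv : 0 < v) (x : ℝ)
    {δ : ℝ} (hδ : 0 < δ) : MemLp ({ξ : ℝ | δ < |ξ|}.indicator (fKer α v x)) 2 volume := by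
  have hS : MeasurableSet {ξ : ℝ | δ < |ξ|} := measurableSet_lt (by fun_prop) (by fun_prop)
  have hmeas : AEStronglyMeasurable ({ξ : ℝ | δ < |ξ|}.indicator (fKer α v x)) volume :=
    ((measurable_fKer α v x).indicator hS).aestronglyMeasurable
  rw [memLp_two_iff_integrable_sq_norm hmeas]
  set a := v + 1 / α with ha
  have ha2 : 1 / 2 < a := by
    have : 1 / 2 < 1 / α := one_div_lt_one_div_of_lt hα0 hα2
    linarith
  have hint : Integrable fun ξ : ℝ => (Set.Ioi δ).indicator (fun u => u ^ (-(2 * a))) |ξ| := by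
    refine integrable_comp_abs (Integrable.integrableOn ?_)
    rw [integrable_indicator_iff measurableSet_Ioi]
    exact integrableOn_Ioi_rpow_of_lt (by linarith) hδ
  refine (hint.const_mul ((2 + |x|) ^ 2)).mono' (hmeas.norm.pow 2)
    (Eventually.of_forall fun ξ => ?_)
  rw [Real.norm_of_nonneg (by positivity)]
  by_cases hξ : δ < |ξ|
  · rw [Set.indicator_of_mem (show ξ ∈ {ξ : ℝ | δ < |ξ|} from hξ),
      Set.indicator_of_mem (show |ξ| ∈ Set.Ioi δ from hξ)]
    have h1 : ‖fKer α v x ξ‖ ≤ (2 + |x|) * |ξ| ^ (-a) := by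
      refine (norm_fKer_le α v x ξ).trans ?_
      rw [domFun]
      gcongr
      exact mul_le_of_le_one_right (by positivity) (min_le_left _ _)
    calc ‖fKer α v x ξ‖ ^ 2 ≤ ((2 + |x|) * |ξ| ^ (-a)) ^ 2 := by gcongr
      _ = (2 + |x|) ^ 2 * |ξ| ^ (-(2 * a)) := by
        rw [mul_pow, ← Real.rpow_natCast (|ξ| ^ (-a)), ← Real.rpow_mul (abs_nonneg ξ)]
        congr 2
        push_cast
        ring
  · rw [Set.indicator_of_notMem (show ξ ∉ {ξ : ℝ | δ < |ξ|} from hξ),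
      Set.indicator_of_notMem (show |ξ| ∉ Set.Ioi δ from hξ)]
    simp

lemma IsLemarieMeyer.abs_mem_Icc_of_psiJK {ψ : 𝓢(ℝ, ℝ)} (hψ : IsLemarieMeyer ψ) {j k : ℤ} {ξ : ℝ}
    (h : fourierHat (psiJK ψ j k) ξ ≠ 0) : |(2 : ℝ) ^ (-j) * ξ| ∈ Set.Icc (2 : ℝ) 9 := by
  refine hψ.abs_mem_Icc fun h0 => h ?_
  rw [fourierHat_psiJK, h0, mul_zero]

lemma IsLemarieMeyer.summable_series {ψ : 𝓢(ℝ, ℝ)} (hψ : IsLemarieMeyer ψ) {α v : ℝ}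
    (hα : 0 < α) (hv : 0 < v) (t ξ : ℝ) :
    Summable fun p : ℤ × ℤ => wCoeff α ψ v p.1 p.2 t * conj (psiHat α ψ p.1 p.2 ξ) := by
  obtain ⟨C, -, h⟩ := hψ.exists_tsum_le hα hv t
  refine Summable.of_enorm ((h ξ).trans_lt ENNReal.ofReal_lt_top).ne

/-- The `α`-dependent powers of two cancel in the product, leaving a term of the `L²` expansion. -/
lemma wCoeff_mul_conj_psiHat (α : ℝ) (ψ : ℝ → ℝ) (v : ℝ) (j k : ℤ) (t ξ : ℝ) :
    wCoeff α ψ v j k t * conj (psiHat α ψ j k ξ) =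
      (∫ η : ℝ, fKer α v t η * fourierHat (psiJK ψ j k) η) *
        conj (fourierHat (psiJK ψ j k) ξ) := by
  have h1 : (2 : ℝ) ^ ((j : ℝ) * (1 / α - 1 / 2)) *
      (2 : ℝ) ^ (-((j : ℝ) * (1 / α - 1 / 2))) = 1 := by
    rw [← Real.rpow_add (by norm_num), add_neg_cancel, Real.rpow_zero]
  have h2 : (((2 : ℝ) ^ ((j : ℝ) * (1 / α - 1 / 2)) : ℝ) : ℂ) *
      (((2 : ℝ) ^ (-((j : ℝ) * (1 / α - 1 / 2))) : ℝ) : ℂ) = 1 := by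
    rw [← Complex.ofReal_mul, h1, Complex.ofReal_one]
  rw [wCoeff, psiHat, map_mul, Complex.conj_ofReal]
  linear_combination (∫ η : ℝ, fKer α v t η * fourierHat (psiJK ψ j k) η) *
    conj (fourierHat (psiJK ψ j k) ξ) * h2

/-- Cut the kernel off at `|η| > δ` and take `|ξ| > 9δ`. A wavelet active at `ξ` has `2^j > δ`, so
its support avoids the cutoff and its coefficient is unchanged. The `L²` expansion gives the limit
along one sequence of index sets, and absolute convergence makes it the unordered sum; then `δ =
1/(m+1)` exhausts `ξ ≠ 0`. -/
lemma IsLemarieMeyer.hasSum_series {ψ : 𝓢(ℝ, ℝ)} (hψ : IsLemarieMeyer ψ) {α v : ℝ}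
    (hα0 : 0 < α) (hα2 : α < 2) (hv : 0 < v) (t : ℝ) :
    ∀ᵐ ξ : ℝ, HasSum (fun p : ℤ × ℤ => wCoeff α ψ v p.1 p.2 t * conj (psiHat α ψ p.1 p.2 ξ))
      (fKer α v t ξ) := by
  have key : ∀ m : ℕ, ∀ᵐ ξ : ℝ, 9 * ((m : ℝ) + 1)⁻¹ < |ξ| → HasSum (fun p : ℤ × ℤ =>
      wCoeff α ψ v p.1 p.2 t * conj (psiHat α ψ p.1 p.2 ξ)) (fKer α v t ξ) := by
    intro m
    set δ : ℝ := ((m : ℝ) + 1)⁻¹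
    have hδ : 0 < δ := by positivity
    obtain ⟨ns, hns, hae⟩ :=
      hψ.exists_seq_tendsto_ae (memLp_two_indicator_fKer hα0 hα2 hv t hδ)
    filter_upwards [hae] with ξ hξ hlt
    have hsum := (hψ.summable_series hα0 hv t ξ).hasSum
    have hlim := hsum.comp hns
    rw [Set.indicator_of_mem (show ξ ∈ {ξ : ℝ | δ < |ξ|} by
      change δ < |ξ|; linarith)] at hξ
    have hterm : ∀ p : ℤ × ℤ, wCoeff α ψ v p.1 p.2 t * conj (psiHat α ψ p.1 p.2 ξ) =
        (∫ η, {ξ : ℝ | δ < |ξ|}.indicator (fKer α v t) η * fourierHat (psiJK ψ p.1 p.2) η) *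
          conj (fourierHat (psiJK ψ p.1 p.2) ξ) := by
      intro p
      rw [wCoeff_mul_conj_psiHat]
      by_cases h0 : fourierHat (psiJK ψ p.1 p.2) ξ = 0
      · simp [h0]
      · congr 2
        funext η
        by_cases h1 : fourierHat (psiJK ψ p.1 p.2) η = 0
        · simp [h1]
        · have h2 := (zpow_le_of_mem_Icc (hψ.abs_mem_Icc_of_psiJK h0)).2
          have h3 := (zpow_le_of_mem_Icc (hψ.abs_mem_Icc_of_psiJK h1)).1
          rw [Set.indicator_of_mem (show η ∈ {ξ : ℝ | δ < |ξ|} by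
            change δ < |η|; linarith)]
    simp only [← hterm] at hξ
    rwa [tendsto_nhds_unique hξ hlim]
  have h0 : ∀ᵐ ξ : ℝ, ξ ≠ 0 := Measure.ae_ne volume 0
  filter_upwards [ae_all_iff.2 key, h0] with ξ hξ hne
  obtain ⟨m, hm⟩ := exists_nat_one_div_lt (show 0 < |ξ| / 9 by positivity)
  refine hξ m ?_
  rw [one_div] at hm
  linarith

end Expansion

/-! ### Tensor products of series -/

section Tensor

variable {ι β : Type*} [Fintype ι]

lemma enorm_finset_prod (f : ι → ℂ) : ‖∏ l, f l‖ₑ = ∏ l, ‖f l‖ₑ := by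
  rw [← ofReal_norm, norm_prod, ENNReal.ofReal_prod_of_nonneg fun l _ => norm_nonneg _]
  simp only [ofReal_norm]

lemma sum_prod_le_prod_tsum (a : ι → β → ℝ≥0∞) (D : Finset (ι → β)) :
    ∑ f ∈ D, ∏ l, a l (f l) ≤ ∏ l, ∑' b, a l b := by
  classical
  have hsub : D ⊆ Fintype.piFinset fun l => D.image fun f => f l := fun f hf =>
    Fintype.mem_piFinset.2 fun l => Finset.mem_image_of_mem (fun f => f l) hf
  refine (Finset.sum_le_sum_of_subset hsub).trans ?_
  rw [← Finset.prod_univ_sum]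
  exact Finset.prod_le_prod' fun l _ => ENNReal.sum_le_tsum _

/-- The product of the absolute sums gives summability, so the value may be computed along the
cofinal boxes `B^ι`, where the sum factorizes. -/
lemma hasSum_pi_prod {a : ι → β → ℂ} {s : ι → ℂ} (h : ∀ l, HasSum (a l) (s l)) :
    HasSum (fun f : ι → β => ∏ l, a l (f l)) (∏ l, s l) := by
  classical
  have hfin : ∀ l, ∑' b, ‖a l b‖ₑ ≠ ∞ := fun l => by
    have h1 := (h l).summable.norm
    simpa only [ofReal_norm] using h1.tsum_ofReal_ne_top
  have hsummable : Summable fun f : ι → β => ∏ l, a l (f l) := by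
    refine Summable.of_enorm (ne_top_of_le_ne_top
      (ENNReal.prod_ne_top (s := Finset.univ) fun l _ => hfin l) ?_)
    rw [ENNReal.tsum_eq_iSup_sum]
    refine iSup_le fun D => ?_
    simp only [enorm_finset_prod]
    exact sum_prod_le_prod_tsum (fun l b => ‖a l b‖ₑ) D
  have hbox : Tendsto (fun B : Finset β => Fintype.piFinset fun _ : ι => B) atTop atTop := by
    refine tendsto_atTop.2 fun D => ?_
    filter_upwards [eventually_ge_atTop (D.biUnion fun f => Finset.univ.image f)] with B hB f hf
    exact Fintype.mem_piFinset.2 fun l => hB (Finset.mem_biUnion.2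
      ⟨f, hf, Finset.mem_image_of_mem f (Finset.mem_univ l)⟩)
  have h1 := hsummable.hasSum.comp hbox
  have h2 : Tendsto (fun B : Finset β => ∏ l, ∑ b ∈ B, a l b) atTop (𝓝 (∏ l, s l)) :=
    tendsto_finsetProd _ fun l _ => h l
  simp only [Finset.prod_univ_sum] at h2
  rw [tendsto_nhds_unique h2 h1]
  exact hsummable.hasSum

lemma integrable_prod_rpow {N : ℕ} {g : Fin N → ℝ → ℝ} {α : ℝ} (hg : ∀ l x, 0 ≤ g l x)
    (h : ∀ l, Integrable fun x => g l x ^ α) :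
    Integrable (fun x : Fin N → ℝ => (∏ l, g l (x l)) ^ α) := by
  have h1 : (fun x : Fin N → ℝ => (∏ l, g l (x l)) ^ α) = fun x => ∏ l, g l (x l) ^ α := by
    funext x
    rw [Real.finsetProd_rpow _ _ fun l _ => hg l (x l)]
  rw [h1]
  exact Integrable.fintype_prod (f := fun l x => g l x ^ α) h

lemma memLp_of_norm_le {N : ℕ} {f : (Fin N → ℝ) → ℂ} {g : (Fin N → ℝ) → ℝ} {α : ℝ} (hα : 0 < α)
    (hf : AEStronglyMeasurable f volume) (hg : Integrable fun x => g x ^ α)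
    (hfg : ∀ x, ‖f x‖ ≤ g x) : MemLp f (ENNReal.ofReal α) volume := by
  rw [← integrable_norm_rpow_iff hf (by simp [hα]) (by simp), ENNReal.toReal_ofReal hα.le]
  refine hg.mono' (hf.norm.aemeasurable.pow_const α).aestronglyMeasurable
    (Eventually.of_forall fun x => ?_)
  rw [Real.norm_of_nonneg (by positivity)]
  exact Real.rpow_le_rpow (norm_nonneg _) (hfg x) hα.le

end Tensor

/-! ### The wavelet expansion of the kernel -/

section Kernel

variable {N : ℕ} {α : ℝ} {ψ : 𝓢(ℝ, ℝ)}

lemma continuous_psiHat (α : ℝ) (ψ : 𝓢(ℝ, ℝ)) (j k : ℤ) : Continuous (psiHat α ψ j k) := by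
  obtain ⟨φ, hφ⟩ := exists_schwartz_psiJK ψ j k
  obtain ⟨g, hg⟩ := exists_schwartz_fourierHat φ
  have h : psiHat α ψ j k = fun ξ =>
      (((2 : ℝ) ^ (-((j : ℝ) * (1 / α - 1 / 2))) : ℝ) : ℂ) * g ξ := by
    funext ξ
    rw [psiHat, hg, funext hφ]
  rw [h]
  exact continuous_const.mul g.continuous

lemma continuous_conj_bigPsiHat (α : ℝ) (ψ : 𝓢(ℝ, ℝ)) (J K : Fin N → ℤ) :
    Continuous fun x => conj (bigPsiHat α ψ J K x) :=
  Complex.continuous_conj.comp (continuous_finsetProd _ fun l _ =>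
    (continuous_psiHat α ψ (J l) (K l)).comp (continuous_apply l))

lemma measurable_kernel (α : ℝ) (H t : Fin N → ℝ) : Measurable (kernel α H t) :=
  Finset.measurable_fun_prod _ fun l _ =>
    (measurable_fKer α (H l) (t l)).comp (measurable_pi_apply l)

lemma IsLemarieMeyer.memLp_conj_bigPsiHat (hψ : IsLemarieMeyer ψ) (hα : 0 < α)
    (J K : Fin N → ℤ) :
    MemLp (fun x => conj (bigPsiHat α ψ J K x)) (ENNReal.ofReal α) volume := by
  refine memLp_of_norm_le hα (continuous_conj_bigPsiHat α ψ J K).aestronglyMeasurable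
    (g := fun x => ∏ l, ‖psiHat α ψ (J l) (K l) (x l)‖) ?_ fun x => ?_
  · refine integrable_prod_rpow (g := fun l ξ => ‖psiHat α ψ (J l) (K l) ξ‖)
      (fun l ξ => norm_nonneg _) fun l => ?_
    refine Continuous.integrable_of_hasCompactSupport
      ((continuous_psiHat α ψ (J l) (K l)).norm.rpow_const fun _ => Or.inr hα.le) ?_
    refine HasCompactSupport.intro (isCompact_Icc (a := -(9 * (2 : ℝ) ^ (J l)))
      (b := 9 * (2 : ℝ) ^ (J l))) fun ξ hξ => ?_
    have h0 : fourierHat (psiJK ψ (J l) (K l)) ξ = 0 := by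
      by_contra hne
      exact hξ (abs_le.1 (zpow_le_of_mem_Icc (hψ.abs_mem_Icc_of_psiJK hne)).2)
    rw [psiHat, h0, mul_zero, norm_zero, Real.zero_rpow hα.ne']
  · rw [Complex.norm_conj, bigPsiHat, norm_prod]

/-- A common dominating function for the kernel and for all partial sums of its expansion. -/
lemma IsLemarieMeyer.exists_dominating (hψ : IsLemarieMeyer ψ) (hα : 0 < α) (H : Fin N → ℝ)
    (hH : ∀ l, 0 < H l ∧ H l < 1) (t : Fin N → ℝ) :
    ∃ G : (Fin N → ℝ) → ℝ, Integrable (fun x => G x ^ α) ∧ (∀ x, 0 ≤ G x) ∧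
      (∀ x, ‖kernel α H t x‖ ≤ G x) ∧
      ∀ (D : Finset ((Fin N → ℤ) × (Fin N → ℤ))) (x : Fin N → ℝ),
        ‖∑ p ∈ D, (∏ l, wCoeff α ψ (H l) (p.1 l) (p.2 l) (t l)) *
          conj (bigPsiHat α ψ p.1 p.2 x)‖ ≤ G x := by
  classical
  choose C hC hsum using fun l => hψ.exists_tsum_le hα (hH l).1 (t l)
  have hC' : ∀ l, 0 ≤ C l + (2 + |t l|) := fun l =>
    add_nonneg (hC l) (add_nonneg zero_le_two (abs_nonneg (t l)))
  have hnn : ∀ l ξ, 0 ≤ (C l + (2 + |t l|)) * domFun (H l + 1 / α) ξ := fun l ξ =>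
    mul_nonneg (hC' l) (domFun_nonneg _ _)
  -- In each factor `C l` dominates the series and `2 + |t l|` the kernel; their sum serves for
  -- both.
  refine ⟨fun x => ∏ l, (C l + (2 + |t l|)) * domFun (H l + 1 / α) (x l), ?_,
    fun x => Finset.prod_nonneg fun l _ => hnn l (x l), fun x => ?_, fun D x => ?_⟩
  · refine integrable_prod_rpow (g := fun l ξ => (C l + (2 + |t l|)) * domFun (H l + 1 / α) ξ)
      hnn fun l => ?_
    simp only [Real.mul_rpow (hC' l) (domFun_nonneg _ _)]
    exact (integrable_domFun_rpow hα (hH l).1 (hH l).2).const_mul _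
  · rw [kernel, norm_prod]
    refine Finset.prod_le_prod (fun l _ => norm_nonneg _) fun l _ =>
      (norm_fKer_le α (H l) (t l) (x l)).trans ?_
    exact mul_le_mul_of_nonneg_right (by linarith [hC l]) (domFun_nonneg _ _)
  · rw [← ENNReal.ofReal_le_ofReal_iff (Finset.prod_nonneg fun l _ => hnn l (x l)), ofReal_norm,
      ENNReal.ofReal_prod_of_nonneg fun l _ => hnn l (x l)]
    -- Reading `(J, K)` as `l ↦ (j_l, k_l)` brings the sum into tensor form.
    set e := Equiv.arrowProdEquivProdArrow (Fin N) (fun _ => ℤ) (fun _ => ℤ)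
    have h1 := sum_prod_le_prod_tsum (fun l (q : ℤ × ℤ) =>
      ‖wCoeff α ψ (H l) q.1 q.2 (t l) * conj (psiHat α ψ q.1 q.2 (x l))‖ₑ)
      (D.map e.symm.toEmbedding)
    rw [Finset.sum_map] at h1
    calc _ ≤ ∑ p ∈ D, ‖(∏ l, wCoeff α ψ (H l) (p.1 l) (p.2 l) (t l)) *
          conj (bigPsiHat α ψ p.1 p.2 x)‖ₑ := enorm_sum_le _ _
      _ = _ := Finset.sum_congr rfl fun p _ => by
        rw [bigPsiHat, map_prod, ← Finset.prod_mul_distrib, enorm_finset_prod]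
        rfl
      _ ≤ _ := h1
      _ ≤ _ := Finset.prod_le_prod' fun l _ => (hsum l (x l)).trans
        (ENNReal.ofReal_le_ofReal (mul_le_mul_of_nonneg_right
          (by linarith [abs_nonneg (t l)]) (domFun_nonneg _ _)))

lemma IsLemarieMeyer.memLp_kernel (hψ : IsLemarieMeyer ψ) (hα : 0 < α) (H : Fin N → ℝ)
    (hH : ∀ l, 0 < H l ∧ H l < 1) (t : Fin N → ℝ) :
    MemLp (kernel α H t) (ENNReal.ofReal α) volume := by
  obtain ⟨G, hG, -, hk, -⟩ := hψ.exists_dominating hα H hH t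
  exact memLp_of_norm_le hα (measurable_kernel α H t).aestronglyMeasurable hG hk

lemma IsLemarieMeyer.ae_hasSum_kernel (hψ : IsLemarieMeyer ψ) (hα0 : 0 < α) (hα2 : α < 2)
    (H : Fin N → ℝ) (hH : ∀ l, 0 < H l ∧ H l < 1) (t : Fin N → ℝ) :
    ∀ᵐ x : Fin N → ℝ, HasSum (fun p : (Fin N → ℤ) × (Fin N → ℤ) =>
      (∏ l, wCoeff α ψ (H l) (p.1 l) (p.2 l) (t l)) * conj (bigPsiHat α ψ p.1 p.2 x))
      (kernel α H t x) := by
  have h1 : ∀ᵐ x : Fin N → ℝ, ∀ l, HasSum (fun q : ℤ × ℤ =>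
      wCoeff α ψ (H l) q.1 q.2 (t l) * conj (psiHat α ψ q.1 q.2 (x l)))
      (fKer α (H l) (t l) (x l)) :=
    ae_all_iff.2 fun l => (Measure.quasiMeasurePreserving_eval
      (fun _ : Fin N => (volume : Measure ℝ)) l).ae (hψ.hasSum_series hα0 hα2 (hH l).1 (t l))
  filter_upwards [h1] with x hx
  have h2 := hasSum_pi_prod hx
  rw [← (Equiv.arrowProdEquivProdArrow (Fin N) (fun _ => ℤ) (fun _ => ℤ)).hasSum_iff]
  refine h2.congr_fun fun f => ?_
  simp only [Function.comp, bigPsiHat, map_prod, ← Finset.prod_mul_distrib]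
  rfl

/-- Dominated convergence for the `α`-th powers with majorant `(2G)^α`. The triangle inequality is
used only pointwise, so `α < 1` is no obstacle. -/
lemma IsLemarieMeyer.tendsto_eLpNorm (hψ : IsLemarieMeyer ψ) (hα0 : 0 < α) (hα2 : α < 2)
    (H : Fin N → ℝ) (hH : ∀ l, 0 < H l ∧ H l < 1) (t : Fin N → ℝ)
    {D : ℕ → Finset ((Fin N → ℤ) × (Fin N → ℤ))} (hD : Tendsto D atTop atTop) :
    Tendsto (fun n => eLpNorm (fun x =>
        (∑ p ∈ D n, (∏ l, wCoeff α ψ (H l) (p.1 l) (p.2 l) (t l)) *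
          conj (bigPsiHat α ψ p.1 p.2 x)) - kernel α H t x)
      (ENNReal.ofReal α) volume) atTop (𝓝 0) := by
  obtain ⟨G, hG, hG0, hk, hs⟩ := hψ.exists_dominating hα0 H hH t
  set d : ℕ → (Fin N → ℝ) → ℂ := fun n x =>
    (∑ p ∈ D n, (∏ l, wCoeff α ψ (H l) (p.1 l) (p.2 l) (t l)) *
      conj (bigPsiHat α ψ p.1 p.2 x)) - kernel α H t x
  have hmeas : ∀ n, Measurable (d n) := fun n =>
    (continuous_finsetSum _ fun p _ =>
      continuous_const.mul (continuous_conj_bigPsiHat α ψ p.1 p.2)).measurable.sub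
      (measurable_kernel α H t)
  have hlim : Tendsto (fun n => ∫⁻ x, ‖d n x‖ₑ ^ α) atTop (𝓝 (∫⁻ _ : Fin N → ℝ, 0)) := by
    refine tendsto_lintegral_of_dominated_convergence
      (fun x => ENNReal.ofReal ((2 : ℝ) ^ α * G x ^ α)) (fun n => (hmeas n).enorm.pow_const α)
      (fun n => Eventually.of_forall fun x => ?_) ?_ ?_
    · simp only
      rw [← ofReal_norm, ENNReal.ofReal_rpow_of_nonneg (norm_nonneg _) hα0.le,
        ← Real.mul_rpow zero_le_two (hG0 x)]
      refine ENNReal.ofReal_le_ofReal (Real.rpow_le_rpow (norm_nonneg _) ?_ hα0.le)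
      refine (norm_sub_le _ _).trans ?_
      linarith [hs (D n) x, hk x]
    · exact ((hG.const_mul _).lintegral_lt_top).ne
    · filter_upwards [hψ.ae_hasSum_kernel hα0 hα2 H hH t] with x hx
      have h1 := (hx.comp hD).sub_const (kernel α H t x)
      rw [sub_self] at h1
      have h2 := (h1.enorm)
      rw [enorm_zero] at h2
      simpa using tendsto_const_mul_rpow_zero h2 hα0 (C := 1) (by simp)
  rw [lintegral_zero] at hlim
  have h3 := tendsto_const_mul_rpow_zero hlim (α := 1 / α) (by positivity) (C := 1) (by simp)
  refine h3.congr fun n => ?_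
  rw [one_mul, lintegral_enorm_rpow_eq hα0, ← ENNReal.rpow_mul, mul_one_div_cancel hα0.ne',
    ENNReal.rpow_one]

/-- Gives the random series the same coefficients as the kernel expansion, since the factors
`2^{-j_l H_l}` multiply to `2^{-⟨J,H⟩}`. -/
lemma IsLemarieMeyer.partialSum_eq (hψ : IsLemarieMeyer ψ) {Ω : Type*} [MeasurableSpace Ω]
    (M : Set (Fin N → ℝ) → Ω → ℂ) (P : Measure Ω) (H : Fin N → ℝ)
    (D : Finset ((Fin N → ℤ) × (Fin N → ℤ))) (t : Fin N → ℝ) (ω : Ω) :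
    partialSum α ψ M P H D t ω = (∑ p ∈ D,
      (∏ l, wCoeff α ψ (H l) (p.1 l) (p.2 l) (t l)) * epsJK α ψ M P p.1 p.2 ω).re := by
  rw [partialSum]
  congr 1
  refine Finset.sum_congr rfl fun p _ => ?_
  simp only [hψ.wCoeff_eq]
  rw [Finset.prod_mul_distrib, ← Complex.ofReal_prod, ← Real.rpow_sum_of_pos two_pos,
    Finset.sum_neg_distrib]
  ring

end Kernel

lemma tendstoInMeasure_re {Ω : Type*} [MeasurableSpace Ω] {P : Measure Ω} {X : ℕ → Ω → ℂ}
    {Y : Ω → ℂ} (h : TendstoInMeasure P X atTop Y) :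
    TendstoInMeasure P (fun n ω => (X n ω).re) atTop fun ω => (Y ω).re := by
  rw [tendstoInMeasure_iff_norm] at *
  intro ε hε
  refine tendsto_of_tendsto_of_tendsto_of_le_of_le tendsto_const_nhds (h ε hε)
    (fun _ => zero_le) fun n => measure_mono fun ω hω => ?_
  rw [Set.mem_ofPred_eq] at hω ⊢
  refine hω.trans ?_
  rw [← Complex.sub_re]
  exact Complex.abs_re_le_norm _

end

end HFSS

theorem mainTheorem3 {N : ℕ} {Ω : Type*} [MeasurableSpace Ω] (P : Measure Ω)
    [IsProbabilityMeasure P] (α : ℝ) (hα0 : 0 < α) (hα2 : α < 2)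
    (H : Fin N → ℝ) (hH : ∀ l, 0 < H l ∧ H l < 1)
    (ψ : 𝓢(ℝ, ℝ)) (hψ : HFSS.IsLemarieMeyer ψ)
    (c : ℝ) (hc : 0 < c) (M : Set (Fin N → ℝ) → Ω → ℂ)
    (hM : HFSS.IsStableRandomMeasure α c M P)
    (D : ℕ → Finset ((Fin N → ℤ) × (Fin N → ℤ)))
    (hDmono : ∀ n, D n ⊆ D (n + 1)) (hDunion : ∀ p, ∃ n, p ∈ D n) :
    -- the coefficients and the sheet are genuine stochastic integrals
    (∀ J K : Fin N → ℤ, HFSS.IsStableIntegral α M P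
      (fun x => conj (HFSS.bigPsiHat α ψ J K x)) (HFSS.epsJK α ψ M P J K)) ∧
    ∀ t : Fin N → ℝ,
      HFSS.IsStableIntegral α M P (HFSS.kernel α H t)
        (HFSS.stableIntegral α M P (HFSS.kernel α H t)) ∧
      -- the wavelet expansion of the kernel converges to it in `L^α`
      Tendsto (fun n => eLpNorm (fun x =>
          (∑ p ∈ D n, (∏ l, HFSS.wCoeff α ψ (H l) (p.1 l) (p.2 l) (t l)) *
            conj (HFSS.bigPsiHat α ψ p.1 p.2 x)) - HFSS.kernel α H t x)
        (ENNReal.ofReal α) volume) atTop (𝓝 0) ∧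
      -- the partial sums converge in probability to the sheet
      TendstoInMeasure P (fun n => HFSS.partialSum α ψ M P H (D n) t) atTop
        (HFSS.sheet α M P H t) := by
  have hD : Tendsto D atTop atTop :=
    tendsto_atTop_finset_of_monotone (monotone_nat_of_le_succ hDmono) hDunion
  have heps : ∀ J K : Fin N → ℤ, HFSS.IsStableIntegral α M P
      (fun x => conj (HFSS.bigPsiHat α ψ J K x)) (HFSS.epsJK α ψ M P J K) := fun J K =>
    HFSS.isStableIntegral_stableIntegral hM hα0 hc (hψ.memLp_conj_bigPsiHat hα0 J K)
  refine ⟨heps, fun t => ?_⟩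
  have hker := HFSS.isStableIntegral_stableIntegral hM hα0 hc (hψ.memLp_kernel hα0 H hH t)
  have hlim := hψ.tendsto_eLpNorm hα0 hα2 H hH t hD
  refine ⟨hker, hlim, ?_⟩
  -- By linearity the finite random sum is a version of the integral of the partial kernel
  -- expansion, so continuity turns `hlim` into convergence in probability.
  have hsum : ∀ n, HFSS.IsStableIntegral α M P _ _ := fun n =>
    HFSS.IsStableIntegral.sum hM (D n) (fun p => heps p.1 p.2)
      fun p => ∏ l, HFSS.wCoeff α ψ (H l) (p.1 l) (p.2 l) (t l)
  have h := HFSS.tendstoInMeasure_re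
    (HFSS.tendstoInMeasure_of_isStableIntegral hM hα0 hc hsum hker hlim)
  simp only [← hψ.partialSum_eq] at h
  exact h
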